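/- **Setting.** Let $\bar\tau$ be an ordered tree with unequal leaves: a tree is either a leaf $\ell$, or an ordered tuple $\tau=(\tau_1,\dots,\tau_m)$, $m\ge 2$, of trees with pairwise disjoint sets of leaves. Write $\sigma\le\tau$ if $\sigma$ is a subtree of $\tau$ (including $\tau$ itself). Let dimensions $n_\ell$ of the leaves and ranks $r_\tau$ ($\tau\le\bar\tau$) be given, with $r_{\bar\tau}=1$; put $n_\tau=\prod_i n_{\tau_i}$, $\mathcal V_\tau=\mathbb R^{r_\tau\times n_{\tau_1}\times\dots\times n_{\tau_m}}$ for $\tau=(\tau_1,\dots,\tau_m)$ and $\mathcal V_\ell=\mathbb R^{r_\ell\times n_\ell}$. Modes are numbered $0,1,\dots,m$; $\mathrm{mat}_i$ is the $i$-th matricization, $\mathrm{Ten}_i$ its inverse and $\times_i$ the mode-$i$ product. A *tree tensor network* (TTN) on $\tau$ in factorized form consists of matrices $\mathbf U_\ell\in\mathbb R^{n_\ell\times r_\ell}$ of full rank $r_\ell$ at the leaves and connection tensors $C_\sigma\in\mathbb R^{r_\sigma\times r_{\sigma_1}\times\dots\times r_{\sigma_m}}$ of full multilinear rank $(r_\sigma,r_{\sigma_1},\dots,r_{\sigma_m})$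 at the other vertices. It represents the tensor $X_\tau\in\mathcal V_\tau$ given recursively by $X_\ell=\mathbf U_\ell^\top$, $X_\sigma=C_\sigma\times_1\mathbf U_{\sigma_1}\cdots\times_m\mathbf U_{\sigma_m}$, $\mathbf U_\sigma=\mathrm{mat}_0(X_\sigma)^\top$. It is *orthonormal* if $\mathbf U_\sigma$ has orthonormal columns for all $\sigma<\tau$. A tensor in $\mathcal V_\tau$ *has full tree rank* $(r_\sigma)_{\sigma\le\tau}$ if it is represented by an orthonormal TTN on $\tau$ with these dimensions and ranks. **Restrictions.** Given orthonormal factors of $Y^0_\tau=C^0_\tau\times_1\mathbf U^0_{\tau_1}\cdots\times_m\mathbf U^0_{\tau_m}$, with $\mathbf U^0_{\tau_i}=\mathrm{mat}_0(X^0_{\tau_i})^\top$, take a QR decomposition $\mathrm{mat}_i(C^0_\tau)^\top=\mathbf Q\mathbf S^\top$ and set $\mathbf V=\mathrm{mat}_i\bigl(\mathrm{Ten}_i(\mathbf Q^\top)\times_{j\neq i}\mathbf U^0_{\tau_j}\bigr)^\top$. The associated prolongation $\pi_{\tau,i}:\mathcal V_{\tau_i}\to\mathcal V_\tau$ and restriction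 $\pi^\dagger_{\tau,i}:\mathcal V_\tau\to\mathcal V_{\tau_i}$ are $$\pi_{\tau,i}(Y)=\mathrm{Ten}_i\bigl((\mathbf V\,\mathrm{mat}_0(Y))^\top\bigr),\qquad \pi^\dagger_{\tau,i}(Z)=\mathrm{Ten}_0\bigl((\mathrm{mat}_i(Z)\mathbf V)^\top\bigr).$$ One has $\pi^\dagger_{\tau,i}(Y^0_\tau)=X^0_{\tau_i}\times_0\mathbf S^\top=:Y^0_{\tau_i}$. Starting from $Y^0_{\bar\tau}=Y^0$, this defines $Y^0_\tau$ for every $\tau\le\bar\tau$ and, for $B\in\mathcal V_{\bar\tau}$, the restricted tensors $B_{\bar\tau}=B$, $B_{\tau_i}=\pi_{\tau,i}^\dagger(B_\tau)$. **One step of the recursive TTN integrator** on $\tau=(\tau_1,\dots,\tau_m)$, from $t_0$ to $t_1$, with function $F_\tau:[t_0,t_1]\times\mathcal V_\tau\to\mathcal V_\tau$ and initial TTN $Y^0_\tau$ in factorized form, is $Y^1_\tau=\Psi_\tau\circ\Phi_\tau^{(m)}\circ\dots\circ\Phi_\tau^{(1)}(Y_\tau^0)$. With $C^0_\tau,\mathbf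 U^0_{\tau_j}$ denoting the factors of the input of the respective subflow: * $\Phi^{(i)}_\tau$: decompose $\mathrm{mat}_i(C^0_\tau)^\top=\mathbf Q\mathbf S^\top$ (QR), form $\pi_{\tau,i},\pi^\dagger_{\tau,i}$ from the input as above, put $F_{\tau_i}=\pi^\dagger_{\tau,i}\circ F_\tau\circ\pi_{\tau,i}$ and $Y^0_{\tau_i}=X^0_{\tau_i}\times_0\mathbf S^\top$. If $\tau_i$ is a leaf, let $Y^1_{\tau_i}=Y_{\tau_i}(t_1)$, where $\dot Y_{\tau_i}=F_{\tau_i}(t,Y_{\tau_i})$, $Y_{\tau_i}(t_0)=Y^0_{\tau_i}$; otherwise let $Y^1_{\tau_i}$ be the result of the integrator on $\tau_i$ for $F_{\tau_i}$ and $Y^0_{\tau_i}$. Decompose $\mathrm{mat}_0(C^1_{\tau_i})^\top=\widehat{\mathbf Q}\widehat{\mathbf S}$ (QR), where $C^1_{\tau_i}$ is the connection tensor of $Y^1_{\tau_i}$ ($Y^1_{\tau_i}$ itself for a leaf); let $X^1_{\tau_i}$ be $Y^1_{\tau_i}$ with the connection tensor replaced by $\mathrm{Ten}_0(\widehat{\mathbf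 Q}^\top)$, and $\mathbf U^1_{\tau_i}=\mathrm{mat}_0(X^1_{\tau_i})^\top$. Solve $\dot{\mathbf S}(t)=-\mathbf U_{\tau_i}^{1,\top}\mathrm{mat}_0\bigl(F_{\tau_i}(t,X^1_{\tau_i}\times_0\mathbf S(t)^\top)\bigr)^\top$, $\mathbf S(t_0)=\widehat{\mathbf S}$, and set $\widetilde{\mathbf S}=\mathbf S(t_1)$. The output has connection tensor $\mathrm{Ten}_i(\widetilde{\mathbf S}\mathbf Q^\top)$, the network $X^1_{\tau_i}$ (that is, basis matrix $\mathbf U^1_{\tau_i}$) at $\tau_i$, and unchanged factors at $\tau_j$, $j\ne i$. * $\Psi_\tau$: solve $\dot C(t)=F_\tau\bigl(t,C(t)\times_{j=1}^m\mathbf U^0_{\tau_j}\bigr)\times_{j=1}^m\mathbf U_{\tau_j}^{0,\top}$, $C(t_0)=C^0_\tau$, and replace $C^0_\tau$ by $C(t_1)$; the other factors are unchanged. On a single leaf the integrator is understood as solving $\dot Y=F(t,Y)$. All differential equations are solved exactly. Any decomposition $M=QR$ with $Q$ having orthonormal columns may be used instead of a QR decomposition (with square factor $R$). **Theorem (Exactness).**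 Let $t_0<t_1$ and let $A:[t_0,t_1]\to\mathcal V_{\bar\tau}$ be continuously differentiable such that $A(t)$ has full tree rank $(r_\tau)_{\tau\le\bar\tau}$ for all $t\in[t_0,t_1]$. Let $Y^0$ be an orthonormal TTN (with connection tensors of full multilinear rank and basis matrices of full rank) representing $A(t_0)$, and suppose that for the restrictions associated with $Y^0$ the following non-degeneracy condition holds: for every subtree $\tau\le\bar\tau$, the restricted tensor $A_\tau(t_1)=(A(t_1))_\tau$ has full tree rank $(r_\sigma)_{\sigma\le\tau}$. Then one step of the recursive TTN integrator with the ranks $(r_\tau)$ for $F(t,Y)=\dot A(t)$, starting from $Y^0$, can be carried out, and for every choice of the orthogonal decompositions its result $Y^1$ represents exactly the tensor $A(t_1)$. -/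

import Mathlib

open Matrix Set

/-- Ordered trees over a set `L` of leaves: a leaf, or an ordered tuple of trees. -/
inductive OTree (L : Type*) where
  | leaf (l : L) : OTree L
  | node {m : ℕ} (c : Fin m → OTree L) : OTree L

namespace OTree

variable {L : Type*}

/-- The set of leaves of a tree. -/
def leaves : OTree L → Set L
  | leaf l => {l}
  | node c => ⋃ i, (c i).leaves

/-- Ordered trees with unequal leaves: every inner vertex has at least two direct subtrees, and
the direct subtrees have pairwise disjoint sets of leaves. -/
def UnequalLeaves : OTree L → Prop
  | leaf _ => True
  | node (m := m) c =>
      2 ≤ m ∧ (∀ i j, i ≠ j → Disjoint (c i).leaves (c j).leaves) ∧ ∀ i, (c i).UnequalLeaves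

/-- The index set (with `n_τ` elements) of the physical indices below the vertex `τ`:
`{1, …, n_l}` for a leaf, and the product of the index sets of the direct subtrees otherwise. -/
def Idx (n : L → ℕ) : OTree L → Type
  | leaf l => Fin (n l)
  | node c => ∀ i, Idx n (c i)

instance instFintypeIdx (n : L → ℕ) : (τ : OTree L) → Fintype (Idx n τ)
  | leaf l => inferInstanceAs (Fintype (Fin (n l)))
  | node c =>
      letI : ∀ i, Fintype (Idx n (c i)) := fun i => instFintypeIdx n (c i)
      inferInstanceAs (Fintype (∀ i, Idx n (c i)))

/-- The space `V_τ = ℝ^{r_τ × n_{τ_1} × ⋯ × n_{τ_m}}` (and `ℝ^{r_l × n_l}` for a leaf). A tensor is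
stored through its matricization in mode `0`, so that `mat_0` and `ten_0` are the identity and
the mode product `X ×₀ S` is the matrix product `S * X`. -/
abbrev V (n : L → ℕ) (r : OTree L → ℕ) (τ : OTree L) : Type :=
  Matrix (Fin (r τ)) (Idx n τ) ℝ

/-- The column index set of the `0`-mode matricization of the factor attached to a vertex. -/
def CoreIdx (n : L → ℕ) (r : OTree L → ℕ) : OTree L → Type
  | leaf l => Fin (n l)
  | node c => ∀ i, Fin (r (c i))

instance instFintypeCoreIdx (n : L → ℕ) (r : OTree L → ℕ) : (τ : OTree L) → Fintype (CoreIdx n r τ)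
  | leaf l => inferInstanceAs (Fintype (Fin (n l)))
  | node c => inferInstanceAs (Fintype (∀ i, Fin (r (c i))))

end OTree

/-! ### Tensors with a mode `0` of index type `α` and modes `i : Fin m` of index types `β i` -/

section Tensor

variable {α : Type*} {m : ℕ} {β γ : Fin m → Type*}

/-- The `i`-th matricization, with row index in mode `i` and column index in all other modes
(mode `0` included). -/
def tmat (i : Fin m) (T : Matrix α (∀ j, β j) ℝ) :
    Matrix (β i) (α × (∀ j : {j : Fin m // j ≠ i}, β j)) ℝ :=
  Matrix.of fun k p => T p.1 ((Equiv.piSplitAt i β).symm (k, p.2))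

/-- The `i`-th tensorization, inverse to `tmat i`. -/
def tten (i : Fin m) (M : Matrix (β i) (α × (∀ j : {j : Fin m // j ≠ i}, β j)) ℝ) :
    Matrix α (∀ j, β j) ℝ :=
  Matrix.of fun a x => M (x i) (a, fun j => x j)

/-- The multilinear product `C ×₀ I ×₁ U₁ ×₂ ⋯ ×ₘ Uₘ`. -/
def tucker [∀ i, Fintype (β i)] (C : Matrix α (∀ i, β i) ℝ) (U : ∀ i, Matrix (γ i) (β i) ℝ) :
    Matrix α (∀ i, γ i) ℝ :=
  Matrix.of fun a x => ∑ l : (∀ i, β i), C a l * ∏ i, U i (x i) (l i)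

/-- The matrix `mat_i (ten_i (Qᵀ) ×₀ I ×_{j ≠ i} U_j)ᵀ`, written out entrywise. -/
def frame (i : Fin m) {κ : Type*} [∀ j, Fintype (β j)]
    (Q : Matrix (α × (∀ j : {j : Fin m // j ≠ i}, β j)) κ ℝ) (U : ∀ j, Matrix (γ j) (β j) ℝ) :
    Matrix (α × (∀ j : {j : Fin m // j ≠ i}, γ j)) κ ℝ :=
  Matrix.of fun p k =>
    ∑ l : (∀ j : {j : Fin m // j ≠ i}, β j), Q (p.1, l) k * ∏ j : {j : Fin m // j ≠ i}, U j (p.2 j) (l j)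

theorem tten_tmat (i : Fin m) (T : Matrix α (∀ j, β j) ℝ) : tten i (tmat i T) = T := by
  ext a x
  exact congrArg (T a) ((Equiv.piSplitAt i β).symm_apply_apply x)

theorem tmat_tten (i : Fin m) (M : Matrix (β i) (α × (∀ j : {j : Fin m // j ≠ i}, β j)) ℝ) :
    tmat i (tten i M) = M := by
  ext k p
  have h := (Equiv.piSplitAt i β).apply_symm_apply (k, p.2)
  have h1 := congrArg Prod.fst h
  have h2 := congrArg Prod.snd h
  exact congrArg₂ (fun a b => M a (p.1, b)) h1 h2

end Tensor

/-- `M = Q * R` is an orthogonal decomposition: `Q` has orthonormal columns and the square factor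
`R` has the property `P`. -/
structure IsOrthDecomp (P : ∀ {k : ℕ}, Matrix (Fin k) (Fin k) ℝ → Prop) {ι : Type*} [Fintype ι]
    {k : ℕ} (M Q : Matrix ι (Fin k) ℝ) (R : Matrix (Fin k) (Fin k) ℝ) : Prop where
  eq_mul : M = Q * R
  orthonormal : Qᵀ * Q = 1
  factor : P R

/-- Upper triangular matrices: with this property of the factor `R` an orthogonal decomposition
is a QR decomposition. -/
def IsUpperTri {k : ℕ} (R : Matrix (Fin k) (Fin k) ℝ) : Prop := ∀ i j, j < i → R i j = 0

/-- No condition on the factor `R`: an arbitrary orthogonal decomposition. -/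
def AnyFactor {k : ℕ} (_ : Matrix (Fin k) (Fin k) ℝ) : Prop := True

/-- `y₁` is the value at `t₁` of a solution of `y' = G(t, y)` on `[t₀, t₁]` with `y(t₀) = y₀`. -/
def SolvesTo {E : Type*} [AddCommGroup E] [Module ℝ E] [TopologicalSpace E] [ContinuousAdd E]
    [ContinuousSMul ℝ E] (G : ℝ → E → E) (t₀ t₁ : ℝ) (y₀ y₁ : E) : Prop :=
  ∃ y : ℝ → E, y t₀ = y₀ ∧ y t₁ = y₁ ∧
    ∀ t ∈ Icc t₀ t₁, HasDerivWithinAt y (G t (y t)) (Icc t₀ t₁) t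

open OTree

/-- A tree tensor network in factorized form: a basis matrix at each leaf, and a connection tensor
of size `r_τ × r_{τ_1} × ⋯ × r_{τ_m}` at every other vertex. -/
inductive TTN {L : Type*} (n : L → ℕ) (r : OTree L → ℕ) : OTree L → Type _
  | leaf {l : L} (U : Matrix (Fin (n l)) (Fin (r (OTree.leaf l))) ℝ) : TTN n r (OTree.leaf l)
  | node {m : ℕ} {c : Fin m → OTree L} (C : Matrix (Fin (r (OTree.node c))) (∀ i, Fin (r (c i))) ℝ)
      (sub : ∀ i, TTN n r (c i)) : TTN n r (OTree.node c)

namespace TTN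

variable {L : Type*} {n : L → ℕ} {r : OTree L → ℕ}

/-- The tensor `X_τ` represented by the network: `U_lᵀ` at a leaf, and
`C_τ ×₀ I ×₁ U_{τ_1} ⋯ ×ₘ U_{τ_m}` with `U_{τ_i} = mat_0(X_{τ_i})ᵀ` otherwise. -/
def tensor : {τ : OTree L} → TTN n r τ → V n r τ
  | _, leaf U => Uᵀ
  | _, node C sub => tucker C fun i => (sub i).tensorᵀ

/-- The matrix `U_τ = mat_0(X_τ)ᵀ`. -/
def basis {τ : OTree L} (Y : TTN n r τ) : Matrix (Idx n τ) (Fin (r τ)) ℝ := Y.tensorᵀ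

/-- The `0`-mode matricization of the factor at the root: the connection tensor, or `U_lᵀ`. -/
def core : {τ : OTree L} → TTN n r τ → Matrix (Fin (r τ)) (CoreIdx n r τ) ℝ
  | _, leaf U => Uᵀ
  | _, node C _ => C

/-- Replace the factor at the root and keep all other factors. -/
def setCore : {τ : OTree L} → TTN n r τ → Matrix (Fin (r τ)) (CoreIdx n r τ) ℝ → TTN n r τ
  | _, leaf _, M => leaf (Matrix.transpose M)
  | _, node _ sub, M => node M sub

/-- The network of `X_τ ×₀ S`: the factor at the root is multiplied by `S` in mode `0`. -/
def mulCore {τ : OTree L} (Y : TTN n r τ) (S : Matrix (Fin (r τ)) (Fin (r τ)) ℝ) : TTN n r τ :=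
  Y.setCore (S * Y.core)

/-- All basis matrices have full rank `r_l`, and all connection tensors have full multilinear rank
`(r_τ, r_{τ_1}, …, r_{τ_m})`. -/
def FullRank : {τ : OTree L} → TTN n r τ → Prop
  | .leaf l, leaf U => U.rank = r (.leaf l)
  | .node c, node C sub =>
      C.rank = r (.node c) ∧ (∀ i, (tmat i C).rank = r (c i)) ∧ ∀ i, (sub i).FullRank

/-- `U_σ` has orthonormal columns for every subtree `σ ≤ τ`. -/
def AllOrthonormal : {τ : OTree L} → TTN n r τ → Prop
  | _, leaf U => Uᵀ * U = 1
  | _, node C sub =>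
      (node C sub).basisᵀ * (node C sub).basis = 1 ∧ ∀ i, (sub i).AllOrthonormal

/-- Orthonormal tree tensor network: `U_σ` has orthonormal columns for every subtree `σ < τ`. -/
def Orthonormal : {τ : OTree L} → TTN n r τ → Prop
  | _, leaf _ => True
  | _, node _ sub => ∀ i, (sub i).AllOrthonormal

end TTN

section Integrator

variable {L : Type*} {n : L → ℕ} {r : OTree L → ℕ}

/-- A tensor of full tree rank `(r_σ)_{σ ≤ τ}`, i.e. an element of the manifold `M_τ`. -/
def HasFullTreeRank {τ : OTree L} (B : V n r τ) : Prop :=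
  ∃ Y : TTN n r τ, Y.FullRank ∧ Y.Orthonormal ∧ Y.tensor = B

section Restriction

variable {m : ℕ} {c : Fin m → OTree L}

/-- The matrix `V_{τ_i} = mat_i (ten_i (Qᵀ) ×₀ I ×_{j ≠ i} U_{τ_j})ᵀ`. -/
def vMat (i : Fin m) (Q : Matrix (Fin (r (.node c)) × (∀ j : {j // j ≠ i}, Fin (r (c j))))
      (Fin (r (c i))) ℝ) (sub : ∀ j, TTN n r (c j)) :
    Matrix (Fin (r (.node c)) × (∀ j : {j // j ≠ i}, Idx n (c j))) (Fin (r (c i))) ℝ :=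
  frame i Q fun j => (sub j).basis

/-- The prolongation `π_{τ,i}(Y) = ten_i ((V mat_0(Y))ᵀ)`. -/
def prolong (i : Fin m)
    (W : Matrix (Fin (r (.node c)) × (∀ j : {j // j ≠ i}, Idx n (c j))) (Fin (r (c i))) ℝ)
    (Y : V n r (c i)) : V n r (.node c) :=
  tten (β := fun j => Idx n (c j)) i (W * Y)ᵀ

/-- The restriction `π_{τ,i}^†(Z) = ten_0 ((mat_i(Z) V)ᵀ)`. -/
def restrict (i : Fin m)
    (W : Matrix (Fin (r (.node c)) × (∀ j : {j // j ≠ i}, Idx n (c j))) (Fin (r (c i))) ℝ)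
    (Z : V n r (.node c)) : V n r (c i) :=
  (tmat (β := fun j => Idx n (c j)) i Z * W)ᵀ

/-- The function `F_{τ_i} = π_{τ,i}^† ∘ F_τ ∘ π_{τ,i}`. -/
def restrictFun (i : Fin m)
    (W : Matrix (Fin (r (.node c)) × (∀ j : {j // j ≠ i}, Idx n (c j))) (Fin (r (c i))) ℝ)
    (F : ℝ → V n r (.node c) → V n r (.node c)) (t : ℝ) (Y : V n r (c i)) : V n r (c i) :=
  restrict i W (F t (prolong i W Y))

end Restriction

/-- For a network `Y⁰_τ` and a tensor `B ∈ V_τ`: the restricted tensors `B_σ` have full tree rank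
for all subtrees `σ ≤ τ`. Here `B_τ = B` and, recursively, `B_{σ_i} = π_{σ,i}^†(B_σ)`, where the
restriction is the one associated with `Y⁰_σ` (through an orthogonal decomposition
`mat_i(C⁰_σ)ᵀ = Q Sᵀ`), and `Y⁰_{σ_i} = π_{σ,i}^†(Y⁰_σ) = X⁰_{σ_i} ×₀ Sᵀ`. -/
def RestrictionsFullRank : {τ : OTree L} → TTN n r τ → V n r τ → Prop
  | .leaf _, _, B => HasFullTreeRank B
  | .node _, .node C sub, B =>
      HasFullTreeRank B ∧ ∀ i, ∃ Q S, IsOrthDecomp AnyFactor (tmat i C)ᵀ Q Sᵀ ∧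
        RestrictionsFullRank ((sub i).mulCore Sᵀ) (restrict i (vMat i Q sub) B)

section Subflows

variable {m : ℕ} {c : Fin m → OTree L}

/-- The subflow `Φ_τ^{(i)}`, as a relation between input `Y⁰` and output `Y¹`. The argument `step`
is the integrator for the direct subtree `τ_i`, as a relation between the function `F_{τ_i}`, the
initial network and the resulting network; `P` is the condition on the square factors of the
orthogonal decompositions. -/
def SubflowPhi (P : ∀ {k : ℕ}, Matrix (Fin k) (Fin k) ℝ → Prop) (t₀ t₁ : ℝ) (i : Fin m)
    (step : (ℝ → V n r (c i) → V n r (c i)) → TTN n r (c i) → TTN n r (c i) → Prop)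
    (F : ℝ → V n r (.node c) → V n r (.node c)) : TTN n r (.node c) → TTN n r (.node c) → Prop
  | .node C₀ sub₀, Y₁ =>
      ∃ Q S, IsOrthDecomp P (tmat i C₀)ᵀ Q Sᵀ ∧
      ∃ Yi : TTN n r (c i),
        step (restrictFun i (vMat i Q sub₀) F) ((sub₀ i).mulCore Sᵀ) Yi ∧
      ∃ Qhat Shat, IsOrthDecomp P Yi.coreᵀ Qhat Shat ∧
      ∃ Stilde,
        SolvesTo (fun t (S' : Matrix (Fin (r (c i))) (Fin (r (c i))) ℝ) =>
            -((Yi.setCore Qhatᵀ).basisᵀ *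
              (restrictFun i (vMat i Q sub₀) F t (S'ᵀ * (Yi.setCore Qhatᵀ).tensor))ᵀ))
          t₀ t₁ Shat Stilde ∧
        Y₁ = .node (tten (β := fun j => Fin (r (c j))) i (Stilde * Qᵀ))
          (Function.update sub₀ i (Yi.setCore Qhatᵀ))

/-- The subflow `Ψ_τ`, as a relation between input and output. -/
def SubflowPsi (t₀ t₁ : ℝ) (F : ℝ → V n r (.node c) → V n r (.node c)) :
    TTN n r (.node c) → TTN n r (.node c) → Prop
  | .node C₀ sub₀, Y₁ =>
      ∃ C₁, SolvesTo (fun t (C : Matrix (Fin (r (.node c))) (∀ i, Fin (r (c i))) ℝ) =>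
            tucker (β := fun j => Idx n (c j)) (F t (tucker C fun j => (sub₀ j).basis))
              fun j => (sub₀ j).basisᵀ)
          t₀ t₁ C₀ C₁ ∧
        Y₁ = .node C₁ sub₀

end Subflows

/-- One step from `t₀` to `t₁` of the recursive TTN integrator on the tree `τ` with the function
`F`, as a relation between the initial network and the resulting network: on `τ = (τ_1, …, τ_m)`
it is `Ψ_τ ∘ Φ_τ^{(m)} ∘ ⋯ ∘ Φ_τ^{(1)}`, and on a leaf the differential equation is solved. -/
def TTNStep (P : ∀ {k : ℕ}, Matrix (Fin k) (Fin k) ℝ → Prop) (t₀ t₁ : ℝ) :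
    (τ : OTree L) → (ℝ → V n r τ → V n r τ) → TTN n r τ → TTN n r τ → Prop
  | .leaf _, F, Y₀, Y₁ => SolvesTo F t₀ t₁ Y₀.tensor Y₁.tensor
  | .node (m := m) c, F, Y₀, Y₁ =>
      ∃ Y : Fin (m + 1) → TTN n r (.node c), Y 0 = Y₀ ∧
        (∀ i : Fin m,
          SubflowPhi P t₀ t₁ i (TTNStep P t₀ t₁ (c i)) F (Y i.castSucc) (Y i.succ)) ∧
        SubflowPsi t₀ t₁ F (Y (Fin.last m)) Y₁

end Integrator

/-! ### Matrices of full row rank and orthogonal decompositions -/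

/-! The right-hand side depends on time only, so every differential equation of the step merely adds
the increment of a linear image of the curve. The problem restricted to a direct subtree is of the
same kind, with the restricted curve, and the proof is an induction over the tree.

At a vertex let B₀, B₁ be the values of the curve at t₀, t₁. The invariant `IsSweep` says that the
connection tensor remains the core of B₀ in the current orthonormal bases, while the bases already
treated span the ranges of the matricizations of B₁. In the i-th subflow the induction hypothesis
returns the restriction of B₁, that is mat_i(B₁) V transposed. Non-degeneracy gives mat_i(B₁) V the
rank r_{τ_i}, and mat_i(B₁) has no larger rank, so the new basis U¹ spans the whole range of
mat_i(B₁) (`IsSweep.range_of_child`). The backward equation for S then leaves U¹ᵀ mat_i(B₀) V = U¹ᵀ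
U⁰ S, which is precisely the exchange of the i-th basis in the core of B₀ (`IsSweep.update`).
Finally Ψ adds the core of B₁ - B₀, and the core of B₁ in the final bases reproduces B₁
(`IsSweep.tucker_final`).

The delicate point is that non-degeneracy is assumed for the frames of the initial network, whereas
the i-th subflow already uses new bases in the modes j < i. For the current frame, mat_i(B₁) V Sᵀ =
mat_i(B₁) mat_i(B₀)ᵀ U_i: the projection onto the basis in mode j is absorbed by B₁ if j < i and by
B₀ if j > i (`IsAdapted.gram`). The right-hand side is the same for the initial frame, so the two
restrictions of B₁ differ by an invertible change of basis in mode 0, and the non-degeneracy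
condition is invariant under such a change (`RestrictionsFullRank.mul`). -/

theorem Matrix.exists_right_inverse_of_rank {ι : Type*} [Fintype ι] {k : ℕ}
    {M : Matrix (Fin k) ι ℝ} (h : M.rank = k) : ∃ D : Matrix ι (Fin k) ℝ, M * D = 1 := by
  classical
  rw [← Matrix.mulVec_surjective_iff_exists_right_inverse]
  have h1 : LinearMap.range M.mulVecLin = ⊤ := by
    apply Submodule.eq_top_of_finrank_eq
    rw [Module.finrank_fin_fun]
    exact h
  exact LinearMap.range_eq_top.mp h1

theorem Matrix.rank_of_right_inverse {ι : Type*} [Fintype ι] {k : ℕ}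
    {M : Matrix (Fin k) ι ℝ} {D : Matrix ι (Fin k) ℝ} (h : M * D = 1) : M.rank = k := by
  refine le_antisymm (M.rank_le_card_height.trans (by simp)) ?_
  have h1 := Matrix.rank_mul_le_left M D
  rwa [h, Matrix.rank_one, Fintype.card_fin] at h1

theorem Matrix.linearIndependent_col_of_left_inverse {ι : Type*} [Fintype ι] {k : ℕ}
    {M : Matrix ι (Fin k) ℝ} {D : Matrix (Fin k) ι ℝ} (h : D * M = 1) :
    LinearIndependent ℝ fun j => (WithLp.toLp 2 fun a => M a j : EuclideanSpace ℝ ι) := by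
  rw [Fintype.linearIndependent_iff]
  intro g hg
  have h1 : M *ᵥ g = 0 := by
    ext a
    have h2 := congrArg (fun x : EuclideanSpace ℝ ι => x a) hg
    simpa [Matrix.mulVec, dotProduct, mul_comm] using h2
  have h3 : g = 0 := by
    rw [← Matrix.one_mulVec g, ← h, ← Matrix.mulVec_mulVec, h1, Matrix.mulVec_zero]
  exact fun i => congrFun h3 i

/-- QR decomposition of a matrix of full column rank. -/
theorem exists_isOrthDecomp_isUpperTri {ι : Type*} [Fintype ι] {k : ℕ}
    {M : Matrix ι (Fin k) ℝ} {D : Matrix (Fin k) ι ℝ} (h : D * M = 1) :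
    ∃ Q R, IsOrthDecomp IsUpperTri M Q R := by
  set f : Fin k → EuclideanSpace ℝ ι := fun j => WithLp.toLp 2 fun a => M a j with hf
  have hli : LinearIndependent ℝ f := Matrix.linearIndependent_col_of_left_inverse h
  set q := InnerProductSpace.gramSchmidtNormed ℝ f with hq
  have ho : Orthonormal ℝ q := InnerProductSpace.gramSchmidtNormed_orthonormal hli
  have hspan : ∀ j, ∃ c : Fin k → ℝ, ∑ i, c i • q i = f j := by
    intro j
    rw [← Submodule.mem_span_range_iff_exists_fun, hq,
      InnerProductSpace.span_gramSchmidtNormed_range, InnerProductSpace.span_gramSchmidt]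
    exact Submodule.subset_span ⟨j, rfl⟩
  choose c hc using hspan
  refine ⟨Matrix.of fun a i => q i a, Matrix.of fun i j => c j i, ?_, ?_, ?_⟩
  · ext a j
    have h2 := congrArg (fun x : EuclideanSpace ℝ ι => x a) (hc j)
    simp only [hf] at h2
    rw [← h2]
    simp [Matrix.mul_apply, mul_comm]
  · ext i j
    have h2 := orthonormal_iff_ite.mp ho i j
    rw [Matrix.one_apply, ← h2]
    simp [Matrix.mul_apply, PiLp.inner_apply, mul_comm]
  -- The entry (i, j) of the factor is the inner product of q_i with the j-th column, which lies in
  -- the span of the q_l with l ≤ j.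
  · intro i j hij
    have h2 : inner ℝ (q i) (f j) = 0 := by
      rw [hq, InnerProductSpace.gramSchmidtNormed, inner_smul_left,
        InnerProductSpace.gramSchmidt_inv_triangular ℝ f hij, mul_zero]
    rw [← hc j, ho.inner_right_fintype] at h2
    exact h2

/-- Every matrix of full column rank has an orthogonal decomposition with the condition `P` on the
square factor. -/
def HasDecomps (P : ∀ {k : ℕ}, Matrix (Fin k) (Fin k) ℝ → Prop) : Prop :=
  ∀ {ι : Type} [Fintype ι] {k : ℕ} (M : Matrix ι (Fin k) ℝ) (D : Matrix (Fin k) ι ℝ),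
    D * M = 1 → ∃ Q R, IsOrthDecomp P M Q R

theorem hasDecomps_isUpperTri : HasDecomps IsUpperTri := fun _ _ h =>
  exists_isOrthDecomp_isUpperTri h

theorem hasDecomps_anyFactor : HasDecomps AnyFactor := fun _ _ h =>
  let ⟨Q, R, hQ⟩ := exists_isOrthDecomp_isUpperTri h
  ⟨Q, R, hQ.eq_mul, hQ.orthonormal, trivial⟩

/-! ### Differential equations with a right-hand side depending on time only -/

section TimeDependent

variable {ι₁ ι₂ κ₁ κ₂ : Type*} [Finite ι₁] [Finite ι₂] [Finite κ₁] [Finite κ₂]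

theorem hasDerivWithinAt_matrix_iff {ι₁ ι₂ : Type*} [Finite ι₁] [Finite ι₂] {f : ℝ → Matrix ι₁ ι₂ ℝ} {f' : Matrix ι₁ ι₂ ℝ} {s : Set ℝ}
    {t : ℝ} : HasDerivWithinAt f f' s t ↔
      ∀ i j, HasDerivWithinAt (fun u => f u i j) (f' i j) s t := by
  have := Fintype.ofFinite ι₁
  have := Fintype.ofFinite ι₂
  have h1 : HasDerivWithinAt f f' s t ↔ ∀ i, HasDerivWithinAt (fun u => f u i) (f' i) s t :=
    hasDerivWithinAt_pi (φ := f) (φ' := f')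
  rw [h1]
  exact forall_congr' fun i => hasDerivWithinAt_pi

/-- Expanding the argument in matrix units makes each entry of the image a finite linear combination
of the entries of `f`, so scalar derivatives suffice. -/
theorem HasDerivWithinAt.matrix_linearMap (Λ : Matrix ι₁ ι₂ ℝ →ₗ[ℝ] Matrix κ₁ κ₂ ℝ)
    {f : ℝ → Matrix ι₁ ι₂ ℝ} {f' : Matrix ι₁ ι₂ ℝ} {s : Set ℝ} {t : ℝ}
    (h : HasDerivWithinAt f f' s t) : HasDerivWithinAt (fun u => Λ (f u)) (Λ f') s t := by
  classical
  have := Fintype.ofFinite ι₁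
  have := Fintype.ofFinite ι₂
  rw [hasDerivWithinAt_matrix_iff] at h ⊢
  have key : ∀ (M : Matrix ι₁ ι₂ ℝ) i j,
      Λ M i j = ∑ a, ∑ b, M a b * Λ (Matrix.single a b 1) i j := by
    intro M i j
    conv_lhs => rw [Matrix.matrix_eq_sum_single M]
    simp only [map_sum, Matrix.sum_apply]
    refine Finset.sum_congr rfl fun a _ => Finset.sum_congr rfl fun b _ => ?_
    have h2 : Matrix.single a b (M a b) = M a b • Matrix.single a b (1 : ℝ) := by
      rw [Matrix.smul_single, smul_eq_mul, mul_one]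
    rw [h2, map_smul, Matrix.smul_apply, smul_eq_mul]
  intro i j
  rw [key]
  rw [show (fun u => Λ (f u) i j) = fun u => ∑ a, ∑ b, f u a b * Λ (Matrix.single a b 1) i j from
    funext fun u => key (f u) i j]
  exact HasDerivWithinAt.fun_sum fun a _ => HasDerivWithinAt.fun_sum fun b _ =>
    (h a b).mul_const _

/-- The difference of a solution and `B` has derivative zero, hence is constant. Used with linear
images of the curve, this settles existence and uniqueness for all three kinds of differential
equations in the step. -/
theorem solvesTo_iff_of_time_dependent {t₀ t₁ : ℝ} (ht : t₀ < t₁) {B B' : ℝ → Matrix ι₁ ι₂ ℝ}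
    (hB : ∀ t ∈ Icc t₀ t₁, HasDerivWithinAt B (B' t) (Icc t₀ t₁) t) (y₀ y₁ : Matrix ι₁ ι₂ ℝ) :
    SolvesTo (fun t _ => B' t) t₀ t₁ y₀ y₁ ↔ y₁ = y₀ + (B t₁ - B t₀) := by
  have h0 : t₀ ∈ Icc t₀ t₁ := left_mem_Icc.mpr ht.le
  have h1 : t₁ ∈ Icc t₀ t₁ := right_mem_Icc.mpr ht.le
  simp only [hasDerivWithinAt_matrix_iff] at hB
  constructor
  · rintro ⟨y, rfl, rfl, hy⟩
    simp only [hasDerivWithinAt_matrix_iff] at hy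
    ext i j
    have hd : ∀ t ∈ Icc t₀ t₁,
        HasDerivWithinAt (fun u => y u i j - B u i j) 0 (Icc t₀ t₁) t := fun t ht' => by
      rw [← sub_self (B' t i j)]
      exact (hy t ht' i j).fun_sub (hB t ht' i j)
    have hc := constant_of_derivWithin_zero (fun t ht' => (hd t ht').differentiableWithinAt)
      (fun t ht' => (hd t (Ico_subset_Icc_self ht')).derivWithin
        (uniqueDiffOn_Icc ht t (Ico_subset_Icc_self ht'))) t₁ h1
    simp only [Matrix.add_apply, Matrix.sub_apply]
    linarith
  · rintro rfl
    refine ⟨fun t => y₀ + (B t - B t₀), by simp, rfl, fun t ht' => ?_⟩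
    rw [hasDerivWithinAt_matrix_iff]
    intro i j
    exact ((hB t ht' i j).sub_const _).const_add _

end TimeDependent

/-! ### Tensor algebra -/

section TensorAlgebra

variable {α α' : Type*}

/-- The Kronecker product of a family of matrices. -/
def kron {ι : Type*} [Fintype ι] {β γ : ι → Type*} (U : ∀ j, Matrix (γ j) (β j) ℝ) :
    Matrix (∀ j, γ j) (∀ j, β j) ℝ :=
  Matrix.of fun x l => ∏ j, U j (x j) (l j)

section Kron

variable {ι : Type*} [Fintype ι] {β γ δ : ι → Type*}

theorem kron_transpose (U : ∀ j, Matrix (γ j) (β j) ℝ) :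
    (kron U)ᵀ = kron fun j => (U j)ᵀ := rfl

theorem kron_mul [DecidableEq ι] [∀ j, Fintype (β j)] [Fintype (∀ j, β j)]
    (W : ∀ j, Matrix (δ j) (β j) ℝ)
    (U : ∀ j, Matrix (β j) (γ j) ℝ) : kron W * kron U = kron fun j => W j * U j := by
  ext x l
  simp only [kron, Matrix.mul_apply, Matrix.of_apply]
  rw [Finset.prod_univ_sum]
  refine Finset.sum_congr ?_ fun p _ => Finset.prod_mul_distrib.symm
  ext; simp

theorem kron_one [∀ j, DecidableEq (β j)] [DecidableEq (∀ j, β j)] :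
    kron (fun j => (1 : Matrix (β j) (β j) ℝ)) = 1 := by
  ext x l
  simp only [kron, Matrix.of_apply, Matrix.one_apply, Finset.prod_ite_zero]
  simp [funext_iff]

end Kron

variable {m : ℕ} {β γ δ : Fin m → Type*}

theorem tucker_eq [∀ j, Fintype (β j)] [Fintype (∀ j, β j)] (C : Matrix α (∀ j, β j) ℝ)
    (U : ∀ j, Matrix (γ j) (β j) ℝ) : tucker C U = C * (kron U)ᵀ := by
  ext a x
  simp only [tucker, kron, Matrix.mul_apply, Matrix.of_apply, Matrix.transpose_apply]
  refine Finset.sum_congr ?_ fun p _ => rfl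
  ext; simp

theorem tucker_tucker [∀ j, Fintype (β j)] [∀ j, Fintype (γ j)] (C : Matrix α (∀ j, β j) ℝ)
    (U : ∀ j, Matrix (γ j) (β j) ℝ) (W : ∀ j, Matrix (δ j) (γ j) ℝ) :
    tucker (tucker C U) W = tucker C fun j => W j * U j := by
  rw [tucker_eq, tucker_eq, tucker_eq, Matrix.mul_assoc, ← Matrix.transpose_mul, kron_mul]

theorem tucker_one [∀ j, Fintype (β j)] [∀ j, DecidableEq (β j)] (C : Matrix α (∀ j, β j) ℝ) :
    tucker C (fun j => (1 : Matrix (β j) (β j) ℝ)) = C := by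
  classical
  rw [tucker_eq, kron_one, Matrix.transpose_one, Matrix.mul_one]

/-- The Kronecker product of an identity in mode `0` and of all `U j` with `j ≠ i`. -/
def kronRest [DecidableEq α] (i : Fin m) (U : ∀ j, Matrix (γ j) (β j) ℝ) :
    Matrix (α × ∀ j : {j : Fin m // j ≠ i}, γ j) (α × ∀ j : {j : Fin m // j ≠ i}, β j) ℝ :=
  kroneckerMap (· * ·) 1 (kron fun j : {j : Fin m // j ≠ i} => U j)

theorem kronRest_transpose [DecidableEq α] (i : Fin m) (U : ∀ j, Matrix (γ j) (β j) ℝ) :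
    (kronRest (α := α) i U)ᵀ = kronRest i fun j => (U j)ᵀ := by
  rw [kronRest, kronRest, ← kron_transpose, ← Matrix.kroneckerMap_transpose, Matrix.transpose_one]

theorem kronRest_congr [DecidableEq α] {i : Fin m} {U W : ∀ j, Matrix (γ j) (β j) ℝ}
    (h : ∀ j, j ≠ i → U j = W j) : kronRest (α := α) i U = kronRest i W := by
  rw [kronRest, kronRest]
  congr 2
  exact funext fun j => h j j.2

theorem kronRest_one [DecidableEq α] [∀ j, DecidableEq (β j)] [DecidableEq (∀ j, β j)] (i : Fin m) :
    kronRest (α := α) i (fun j => (1 : Matrix (β j) (β j) ℝ)) = 1 := by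
  classical
  rw [kronRest, kron_one]
  convert Matrix.one_kronecker_one

theorem frame_eq [Fintype α] [DecidableEq α] {κ : Type*} [∀ j, Fintype (β j)] (i : Fin m)
    (Q : Matrix (α × (∀ j : {j : Fin m // j ≠ i}, β j)) κ ℝ) (U : ∀ j, Matrix (γ j) (β j) ℝ) :
    frame i Q U = kronRest (α := α) i U * Q := by
  ext p k
  simp only [frame, kronRest, kron, Matrix.mul_apply, Matrix.of_apply, Fintype.sum_prod_type,
    Matrix.kroneckerMap_apply, Matrix.one_apply, ite_mul, one_mul, zero_mul]
  rw [Finset.sum_eq_single p.1 (fun a _ ha => by simp [ha.symm]) (by simp)]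
  simp [mul_comm]

theorem tmat_tucker [Fintype α] [DecidableEq α] [∀ j, Fintype (β j)] (i : Fin m)
    (C : Matrix α (∀ j, β j) ℝ) (U : ∀ j, Matrix (γ j) (β j) ℝ) :
    tmat i (tucker C U) = U i * (tmat i C * (kronRest (α := α) i U)ᵀ) := by
  classical
  rw [← Matrix.mul_assoc]
  ext k p
  simp only [tmat, tucker, kronRest, kron, Matrix.mul_apply, Matrix.of_apply,
    Matrix.transpose_apply, Matrix.kroneckerMap_apply, Fintype.sum_prod_type, Matrix.one_apply,
    ite_mul, one_mul, zero_mul, Finset.sum_mul]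
  rw [Finset.sum_eq_single p.1 (fun a _ ha => by simp [ha.symm]) (by simp)]
  -- The sum over all index tuples is split into the i-th index and the remaining ones, so that the
  -- i-th factor separates from the Kronecker product.
  rw [← (Equiv.piSplitAt i β).symm.sum_comp, Fintype.sum_prod_type, Finset.sum_comm]
  refine Finset.sum_congr rfl fun l _ => Finset.sum_congr rfl fun b _ => ?_
  rw [Fintype.prod_eq_mul_prod_subtype_ne _ i, if_pos rfl]
  have e1 : ∀ (b : β i) l, (Equiv.piSplitAt i β).symm (b, l) i = b := fun b l => by simp
  have e2 : ∀ (b : γ i) l, (Equiv.piSplitAt i γ).symm (b, l) i = b := fun b l => by simp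
  have e3 : ∀ j : {j : Fin m // j ≠ i}, U j ((Equiv.piSplitAt i γ).symm (k, p.2) j)
      ((Equiv.piSplitAt i β).symm (b, l) j) = U j (p.2 j) (l j) := fun j => by
    have e4 : (Equiv.piSplitAt i β).symm (b, l) j = l j := by simp [j.2]
    have e5 : (Equiv.piSplitAt i γ).symm (k, p.2) j = p.2 j := by simp [j.2]
    rw [e4, e5]
  rw [e1, e2, Finset.prod_congr rfl fun j _ => e3 j]
  ring

/-- The matrix acting by `M` in mode `0` on the column indices of the `i`-th matricization. -/
def kronZero (β : Fin m → Type*) [∀ j, DecidableEq (β j)] (i : Fin m) (M : Matrix α' α ℝ) :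
    Matrix (α' × ∀ j : {j : Fin m // j ≠ i}, β j) (α × ∀ j : {j : Fin m // j ≠ i}, β j) ℝ :=
  kroneckerMap (· * ·) M 1

theorem kronZero_transpose [∀ j, DecidableEq (β j)] (i : Fin m) (M : Matrix α' α ℝ) :
    (kronZero β i M)ᵀ = kronZero β i Mᵀ := by
  rw [kronZero, kronZero, ← Matrix.kroneckerMap_transpose, Matrix.transpose_one]

theorem kronZero_mul {α'' : Type*} [Fintype α] [∀ j, Fintype (β j)] [∀ j, DecidableEq (β j)]
    (i : Fin m) (M : Matrix α' α ℝ) (N : Matrix α α'' ℝ) :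
    kronZero β i M * kronZero β i N = kronZero β i (M * N) := by
  rw [kronZero, kronZero, kronZero, ← Matrix.mul_kronecker_mul, Matrix.mul_one]

theorem kronZero_one [DecidableEq α] [∀ j, DecidableEq (β j)] (i : Fin m) :
    kronZero β i (1 : Matrix α α ℝ) = 1 := Matrix.one_kronecker_one

theorem tmat_mul [Fintype α] [∀ j, Fintype (β j)] [∀ j, DecidableEq (β j)] (i : Fin m)
    (M : Matrix α' α ℝ) (T : Matrix α (∀ j, β j) ℝ) :
    tmat i (M * T) = tmat i T * (kronZero β i M)ᵀ := by
  ext k p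
  simp only [tmat, kronZero, Matrix.mul_apply, Matrix.of_apply, Matrix.transpose_apply,
    Matrix.kroneckerMap_apply, Fintype.sum_prod_type, Matrix.one_apply, mul_ite, mul_one, mul_zero]
  refine Finset.sum_congr rfl fun a _ => ?_
  rw [Finset.sum_eq_single p.2 (fun l _ hl => by simp [hl.symm]) (by simp)]
  simp [mul_comm]

theorem kronZero_mul_kronRest [Fintype α] [DecidableEq α] [Fintype α'] [DecidableEq α']
    [∀ j, Fintype (β j)] [∀ j, DecidableEq (β j)] [∀ j, Fintype (γ j)] [∀ j, DecidableEq (γ j)]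
    (i : Fin m) (M : Matrix α' α ℝ) (U : ∀ j, Matrix (γ j) (β j) ℝ) :
    kronZero γ i M * kronRest (α := α) i U = kronRest (α := α') i U * kronZero β i M := by
  rw [kronRest, kronRest, kronZero, kronZero, ← Matrix.mul_kronecker_mul,
    ← Matrix.mul_kronecker_mul, Matrix.mul_one, Matrix.one_mul, Matrix.one_mul, Matrix.mul_one]

theorem tmat_injective (i : Fin m) :
    Function.Injective (tmat (α := α) (β := β) i) :=
  Function.LeftInverse.injective (tten_tmat i)

/-- If every `P j` fixes the `j`-th matricization, the multilinear product with `P` is trivial. -/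
theorem tucker_eq_self [Fintype α] [∀ j, Fintype (β j)] {P : ∀ j, Matrix (β j) (β j) ℝ}
    {T : Matrix α (∀ j, β j) ℝ} (h : ∀ j, P j * tmat j T = tmat j T) : tucker T P = T := by
  classical
  -- The factors are inserted one mode at a time; inserting `P i` alone changes `T` only through its
  -- i-th matricization, which is fixed.
  have key : ∀ s : Finset (Fin m), tucker T (fun j => if j ∈ s then P j else 1) = T := by
    intro s
    induction s using Finset.induction_on with
    | empty => simpa using tucker_one T
    | insert i s hi ih =>
      conv_rhs => rw [← ih]
      have h1 : tucker T (Function.update (fun j => (1 : Matrix (β j) (β j) ℝ)) i (P i)) = T := by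
        apply tmat_injective i
        rw [tmat_tucker, Function.update_self, kronRest_congr (W := fun j => 1), kronRest_one,
          Matrix.transpose_one, Matrix.mul_one, h]
        intro j hj
        rw [Function.update_of_ne hj]
      conv_rhs => rw [← h1, tucker_tucker]
      congr 1
      ext1 j
      by_cases hj : j = i
      · subst hj
        simp [hi]
      · simp [hj]
  simpa using key Finset.univ

end TensorAlgebra

/-! ### Matricizations, frames and orthonormal bases at one vertex -/

section Vertex

variable {α : Type*} [Fintype α] [DecidableEq α] {m : ℕ} {β γ δ : Fin m → Type*}

theorem kronRest_mul [∀ j, Fintype (γ j)] (i : Fin m) (W : ∀ j, Matrix (δ j) (γ j) ℝ) (U : ∀ j, Matrix (γ j) (β j) ℝ) :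
    kronRest (α := α) i W * kronRest (α := α) i U = kronRest i fun j => W j * U j := by
  rw [kronRest, kronRest, kronRest, ← Matrix.mul_kronecker_mul, Matrix.one_mul, kron_mul]

theorem tmat_tucker_transpose [∀ j, Fintype (γ j)] (i : Fin m) (T : Matrix α (∀ j, γ j) ℝ)
    (U : ∀ j, Matrix (γ j) (β j) ℝ) :
    tmat i (tucker T fun j => (U j)ᵀ) = (U i)ᵀ * (tmat i T * kronRest (α := α) i U) := by
  rw [tmat_tucker, kronRest_transpose]
  rfl

theorem frame_mul [∀ j, Fintype (β j)] {i : Fin m} {κ κ' : Type*} [Fintype κ]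
    (Q : Matrix (α × (∀ j : {j : Fin m // j ≠ i}, β j)) κ ℝ) (S : Matrix κ κ' ℝ)
    (U : ∀ j, Matrix (γ j) (β j) ℝ) : frame i (Q * S) U = frame i Q U * S := by
  rw [frame_eq, frame_eq, Matrix.mul_assoc]

variable [∀ j, Fintype (β j)] [∀ j, Fintype (γ j)]

/-- With the identity placed in mode i, all modes satisfy the assumption of `tucker_eq_self`; the
i-th matricization of that identity is the claim. -/
theorem tmat_mul_kronRest_of_fix {i : Fin m} {P : ∀ j, Matrix (γ j) (γ j) ℝ}
    {X : Matrix α (∀ j, γ j) ℝ} (h : ∀ j, j ≠ i → P j * tmat j X = tmat j X) :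
    tmat i X * (kronRest (α := α) i P)ᵀ = tmat i X := by
  classical
  have h1 : tucker X (Function.update P i 1) = X := by
    apply tucker_eq_self
    intro j
    by_cases hj : j = i
    · subst hj
      rw [Function.update_self, Matrix.one_mul]
    · rw [Function.update_of_ne hj, h j hj]
  conv_rhs => rw [← h1, tmat_tucker, Function.update_self, Matrix.one_mul]
  congr 2
  exact kronRest_congr fun j hj => (Function.update_of_ne hj _ _).symm

/-- The restriction of `T` with the frame coming from the core of `T` in the bases `U`. -/
theorem tmat_mul_frame_self {i : Fin m} {T : Matrix α (∀ j, γ j) ℝ}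
    {U : ∀ j, Matrix (γ j) (β j) ℝ} {k : ℕ}
    {Q : Matrix (α × ∀ j : {j : Fin m // j ≠ i}, β j) (Fin k) ℝ} {S : Matrix (β i) (Fin k) ℝ}
    (hfix : U i * (U i)ᵀ * tmat i T = tmat i T)
    (hQ : (tmat i (tucker T fun j => (U j)ᵀ))ᵀ = Q * Sᵀ) (hQQ : Qᵀ * Q = 1) :
    tmat i T * frame i Q U = U i * S := by
  have h1 : tmat i (tucker T fun j => (U j)ᵀ) = S * Qᵀ := by
    rw [← Matrix.transpose_transpose (tmat i _), hQ, Matrix.transpose_mul,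
      Matrix.transpose_transpose]
  rw [frame_eq]
  calc tmat i T * (kronRest (α := α) i U * Q)
      = U i * ((U i)ᵀ * (tmat i T * kronRest (α := α) i U)) * Q := by
        conv_lhs => rw [← hfix]
        simp only [Matrix.mul_assoc]
    _ = U i * S := by
        rw [← tmat_tucker_transpose, h1, Matrix.mul_assoc, Matrix.mul_assoc, hQQ, Matrix.mul_one]

/-- The Gram matrix of `X` and `T` in mode `i` does not see projections, in the other modes,
that fix `X` or `T`. -/
theorem tmat_mul_frame_core {i : Fin m} {X T : Matrix α (∀ j, γ j) ℝ}
    {U : ∀ j, Matrix (γ j) (β j) ℝ}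
    (hfix : ∀ j, j ≠ i → U j * (U j)ᵀ * tmat j X = tmat j X ∨
      U j * (U j)ᵀ * tmat j T = tmat j T) :
    tmat i X * frame i (tmat i (tucker T fun j => (U j)ᵀ))ᵀ U =
      tmat i X * (tmat i T)ᵀ * U i := by
  classical
  -- In each mode j ≠ i the projection U_j U_jᵀ occurs once. `P₁` collects the projections handed to
  -- `X`, and `P₂` those that must be handed to `T`.
  let P₁ : ∀ j, Matrix (γ j) (γ j) ℝ := fun j =>
    if U j * (U j)ᵀ * tmat j X = tmat j X then U j * (U j)ᵀ else 1
  let P₂ : ∀ j, Matrix (γ j) (γ j) ℝ := fun j =>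
    if U j * (U j)ᵀ * tmat j X = tmat j X then 1 else U j * (U j)ᵀ
  have hP₁ : ∀ j, (P₁ j)ᵀ = P₁ j := fun j => by
    simp only [P₁]; split_ifs <;> simp
  have hP : kronRest (α := α) i U * (kronRest (α := α) i U)ᵀ =
      (kronRest (α := α) i P₁)ᵀ * kronRest (α := α) i P₂ := by
    rw [kronRest_transpose, kronRest_transpose, kronRest_mul, kronRest_mul]
    refine kronRest_congr fun j _ => ?_
    rw [hP₁]
    simp only [P₁, P₂]
    split_ifs <;> simp
  have hX : tmat i X * (kronRest (α := α) i P₁)ᵀ = tmat i X := by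
    apply tmat_mul_kronRest_of_fix
    intro j _
    simp only [P₁]
    split_ifs with h
    · exact h
    · rw [Matrix.one_mul]
  have hT : tmat i T * (kronRest (α := α) i P₂)ᵀ = tmat i T := by
    apply tmat_mul_kronRest_of_fix
    intro j hj
    simp only [P₂]
    split_ifs with h
    · rw [Matrix.one_mul]
    · exact (hfix j hj).resolve_left h
  rw [frame_eq, tmat_tucker_transpose, Matrix.transpose_mul, Matrix.transpose_mul,
    Matrix.transpose_transpose]
  calc tmat i X * (kronRest (α := α) i U * ((kronRest (α := α) i U)ᵀ * (tmat i T)ᵀ * U i))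
      = tmat i X * (kronRest (α := α) i U * (kronRest (α := α) i U)ᵀ) * (tmat i T)ᵀ * U i := by
        simp only [Matrix.mul_assoc]
    _ = (tmat i X * (kronRest (α := α) i P₁)ᵀ) *
          ((tmat i T * (kronRest (α := α) i P₂)ᵀ)ᵀ) * U i := by
        rw [hP, Matrix.transpose_mul, Matrix.transpose_transpose]
        simp only [Matrix.mul_assoc]
    _ = _ := by rw [hX, hT]

/-- Replacing the basis in mode `i` of the core of `T`. -/
theorem tten_mul_tmat_core {i : Fin m} {T : Matrix α (∀ j, γ j) ℝ}
    {U : ∀ j, Matrix (γ j) (β j) ℝ} (hfix : U i * (U i)ᵀ * tmat i T = tmat i T)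
    {U' : ∀ j, Matrix (γ j) (β j) ℝ} (hU' : ∀ j, j ≠ i → U' j = U j) :
    tten i ((U' i)ᵀ * U i * tmat i (tucker T fun j => (U j)ᵀ)) =
      tucker T fun j => (U' j)ᵀ := by
  apply tmat_injective i
  rw [tmat_tten, tmat_tucker_transpose, tmat_tucker_transpose, kronRest_congr hU']
  conv_rhs => rw [← hfix]
  simp only [Matrix.mul_assoc]

theorem mul_transpose_mul_tmat_tucker [∀ j, DecidableEq (β j)] {U : ∀ j, Matrix (γ j) (β j) ℝ}
    {i : Fin m} (hU : (U i)ᵀ * U i = 1) (C : Matrix α (∀ j, β j) ℝ) :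
    U i * (U i)ᵀ * tmat i (tucker C U) = tmat i (tucker C U) := by
  rw [tmat_tucker, Matrix.mul_assoc, ← Matrix.mul_assoc _ (U i), hU, Matrix.one_mul]

/-- A change of basis in mode `0` changes the restrictions by a change of basis. -/
theorem tmat_mul_mul_frame [∀ j, DecidableEq (β j)] {i : Fin m} {k : ℕ} {M T : Matrix α α ℝ}
    (hMT : Mᵀ * T = 1) {Q Q' : Matrix (α × (∀ j : {j : Fin m // j ≠ i}, β j)) (Fin k) ℝ}
    {R N : Matrix (Fin k) (Fin k) ℝ} (hQ : kronZero β i T * Q = Q' * R) (hRN : R * N = 1)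
    (B : Matrix α (∀ j, γ j) ℝ) (U : ∀ j, Matrix (γ j) (β j) ℝ) :
    tmat i (M * B) * frame i Q' U = tmat i B * frame i Q U * N := by
  classical
  have h1 : kronZero β i T * Q * N = Q' := by rw [hQ, Matrix.mul_assoc, hRN, Matrix.mul_one]
  have h2 : (kronZero γ i M)ᵀ * kronZero γ i T = 1 := by
    rw [kronZero_transpose, kronZero_mul, hMT, kronZero_one]
  rw [frame_eq, frame_eq, tmat_mul, ← h1]
  calc tmat i B * (kronZero γ i M)ᵀ * (kronRest (α := α) i U * (kronZero β i T * Q * N))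
      = tmat i B * ((kronZero γ i M)ᵀ * (kronRest (α := α) i U * kronZero β i T) * Q * N) := by
        simp only [Matrix.mul_assoc]
    _ = _ := by
        rw [← kronZero_mul_kronRest, ← Matrix.mul_assoc _ (kronZero γ i T), h2, Matrix.one_mul]
        simp only [Matrix.mul_assoc]

end Vertex

/-- If `Z` has a factorization of rank `k`, and `Z * V` has rank `k`, then an orthonormal basis of
the range of `Z * V` spans the range of `Z`. -/
theorem mul_transpose_mul_of_range {N M : Type*} [Fintype N] [Fintype M] {k : ℕ}
    {Z : Matrix N M ℝ} {U : Matrix N (Fin k) ℝ} {G : Matrix (Fin k) M ℝ} (hZ : Z = U * G)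
    {V : Matrix M (Fin k) ℝ} {D : Matrix (Fin k) N ℝ} (hD : D * (Z * V) = 1)
    {W : Matrix N (Fin k) ℝ} (hW : Wᵀ * W = 1) {S : Matrix (Fin k) (Fin k) ℝ}
    (hS : Z * V = W * S) : W * Wᵀ * Z = Z := by
  -- Both `D * U` and `G * V` are square, so they are inverse to each other in either order. This
  -- recovers `U` from `Z * V`, and the range of `U` contains that of `Z`.
  have h1 : D * U * (G * V) = 1 := by
    rw [← hD, hZ]
    simp only [Matrix.mul_assoc]
  have h2 : Z * V * (D * U) = U := by
    rw [hZ, Matrix.mul_assoc U G V, Matrix.mul_assoc, mul_eq_one_comm.mp h1, Matrix.mul_one]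
  have h3 : W * Wᵀ * (Z * V) = Z * V := by
    rw [hS, Matrix.mul_assoc, ← Matrix.mul_assoc Wᵀ, hW, Matrix.one_mul]
  have h4 : W * Wᵀ * U = U := by
    rw [← h2, ← Matrix.mul_assoc, h3]
  rw [hZ, ← Matrix.mul_assoc, h4]

/-! ### Tree tensor networks -/

namespace TTN

variable {L : Type*} {n : L → ℕ} {r : OTree L → ℕ}

instance instDecidableEqCoreIdx (n : L → ℕ) (r : OTree L → ℕ) :
    (τ : OTree L) → DecidableEq (CoreIdx n r τ)
  | .leaf l => inferInstanceAs (DecidableEq (Fin (n l)))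
  | .node c => inferInstanceAs (DecidableEq (∀ i, Fin (r (c i))))

/-- The matrix with `U_τ = kronBasis * mat_0(C_τ)ᵀ`: the identity at a leaf, and the Kronecker
product of the bases of the direct subtrees otherwise. -/
def kronBasis : {τ : OTree L} → TTN n r τ → Matrix (Idx n τ) (CoreIdx n r τ) ℝ
  | .leaf l, leaf _ => (1 : Matrix (Fin (n l)) (Fin (n l)) ℝ)
  | .node _, node _ sub => kron fun i => (sub i).basis

theorem mul_one_transpose {κ ι : Type*} [Fintype ι] [DecidableEq ι] (M : Matrix κ ι ℝ) :
    M * (1 : Matrix ι ι ℝ)ᵀ = M := by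
  rw [Matrix.transpose_one, Matrix.mul_one]

theorem tensor_eq {τ : OTree L} (Y : TTN n r τ) : Y.tensor = Y.core * Y.kronBasisᵀ := by
  cases Y with
  | @leaf l U => exact (mul_one_transpose Uᵀ).symm
  | node C sub => exact tucker_eq _ _

theorem tensor_setCore {τ : OTree L} (Y : TTN n r τ)
    (M : Matrix (Fin (r τ)) (CoreIdx n r τ) ℝ) :
    (Y.setCore M).tensor = M * Y.kronBasisᵀ := by
  cases Y with
  | @leaf l U => exact (mul_one_transpose (ι := Fin (n l)) M).symm
  | node C sub => exact tucker_eq _ _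

theorem basis_setCore {τ : OTree L} (Y : TTN n r τ)
    (M : Matrix (Fin (r τ)) (CoreIdx n r τ) ℝ) :
    (Y.setCore M).basis = Y.kronBasis * Mᵀ := by
  rw [basis, tensor_setCore, Matrix.transpose_mul, Matrix.transpose_transpose]

theorem tensor_mulCore {τ : OTree L} (Y : TTN n r τ) (S : Matrix (Fin (r τ)) (Fin (r τ)) ℝ) :
    (Y.mulCore S).tensor = S * Y.tensor := by
  rw [mulCore, tensor_setCore, tensor_eq, Matrix.mul_assoc]

theorem mulCore_mulCore {τ : OTree L} (Y : TTN n r τ)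
    (S T : Matrix (Fin (r τ)) (Fin (r τ)) ℝ) :
    (Y.mulCore S).mulCore T = Y.mulCore (T * S) := by
  cases Y with
  | leaf U => exact congrArg leaf (congrArg Matrix.transpose (Matrix.mul_assoc T S Uᵀ).symm)
  | node C sub => exact congrArg (fun M => node M sub) (Matrix.mul_assoc T S C).symm

theorem Orthonormal.setCore {τ : OTree L} {Y : TTN n r τ} (h : Y.Orthonormal)
    (M : Matrix (Fin (r τ)) (CoreIdx n r τ) ℝ) : (Y.setCore M).Orthonormal := by
  cases Y with
  | leaf U => trivial
  | node C sub => exact h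

theorem AllOrthonormal.basis {τ : OTree L} {Y : TTN n r τ} (h : Y.AllOrthonormal) :
    Y.basisᵀ * Y.basis = 1 := by
  cases Y with
  | leaf U => exact h
  | node C sub => exact h.1

theorem AllOrthonormal.orthonormal {τ : OTree L} {Y : TTN n r τ} (h : Y.AllOrthonormal) :
    Y.Orthonormal := by
  cases Y with
  | leaf U => trivial
  | node C sub => exact h.2

theorem kronBasis_node_transpose_mul {m : ℕ} {c : Fin m → OTree L}
    (C : Matrix (Fin (r (.node c))) (∀ i, Fin (r (c i))) ℝ) {sub : ∀ i, TTN n r (c i)}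
    (h : ∀ i, (sub i).basisᵀ * (sub i).basis = 1) :
    (node C sub).kronBasisᵀ * (node C sub).kronBasis = 1 := by
  refine (kron_mul (fun i => (sub i).basisᵀ) fun i => (sub i).basis).trans ?_
  simp only [h]
  exact kron_one

theorem Orthonormal.kronBasis {τ : OTree L} {Y : TTN n r τ} (h : Y.Orthonormal) : Y.kronBasisᵀ * Y.kronBasis = 1 := by
  cases Y with
  | @leaf l U =>
    have h1 : (1 : Matrix (Fin (n l)) (Fin (n l)) ℝ)ᵀ * 1 = 1 := by
      rw [Matrix.transpose_one, Matrix.one_mul]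
    exact h1
  | node C sub => exact kronBasis_node_transpose_mul C fun i => (h i).basis

theorem FullRank.exists_core_mul {τ : OTree L} {Y : TTN n r τ} (h : Y.FullRank) :
    ∃ D : Matrix (CoreIdx n r τ) (Fin (r τ)) ℝ, Y.core * D = 1 := by
  apply Matrix.exists_right_inverse_of_rank
  cases Y with
  | leaf U => exact (Matrix.rank_transpose U).trans h
  | node C sub => exact h.1

theorem exists_tensor_mul {τ : OTree L} {Y : TTN n r τ}
    (hY : Y.kronBasisᵀ * Y.kronBasis = 1) (h : ∃ D : Matrix (CoreIdx n r τ) (Fin (r τ)) ℝ, Y.core * D = 1) :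
    ∃ D : Matrix (Idx n τ) (Fin (r τ)) ℝ, Y.tensor * D = 1 := by
  obtain ⟨D, hD⟩ := h
  refine ⟨Y.kronBasis * D, ?_⟩
  rw [tensor_eq, Matrix.mul_assoc, ← Matrix.mul_assoc _ Y.kronBasis, hY, Matrix.one_mul, hD]

theorem FullRank.mulCore {τ : OTree L} {Y : TTN n r τ} (h : Y.FullRank)
    {M N : Matrix (Fin (r τ)) (Fin (r τ)) ℝ} (hNM : N * M = 1) : (Y.mulCore M).FullRank := by
  have hMN : M * N = 1 := mul_eq_one_comm.mp hNM
  have key : (M * Y.core).rank = r τ := by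
    obtain ⟨D, hD⟩ := h.exists_core_mul
    refine Matrix.rank_of_right_inverse (D := D * N) ?_
    rw [Matrix.mul_assoc, ← Matrix.mul_assoc Y.core, hD, Matrix.one_mul, hMN]
  cases Y with
  | leaf U => exact (Matrix.rank_transpose _).trans key
  | @node m c C sub =>
    refine ⟨key, fun i => ?_, h.2.2⟩
    obtain ⟨D, hD⟩ := Matrix.exists_right_inverse_of_rank (h.2.1 i)
    refine Matrix.rank_of_right_inverse (D := (kronZero (fun j => Fin (r (c j))) i N)ᵀ * D) ?_
    refine (congrArg (· * _) (tmat_mul i M C)).trans ?_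
    rw [Matrix.mul_assoc, ← Matrix.mul_assoc _ᵀ, ← Matrix.transpose_mul, kronZero_mul (β := fun j => Fin (r (c j))),
      hNM, kronZero_one, Matrix.transpose_one, Matrix.one_mul, hD]

end TTN

/-! ### Consequences of full tree rank -/

section FullTreeRank

variable {L : Type*} {n : L → ℕ} {r : OTree L → ℕ}

theorem HasFullTreeRank.exists_mul_eq_one {τ : OTree L} {B : V n r τ} (h : HasFullTreeRank B) :
    ∃ D : Matrix (Idx n τ) (Fin (r τ)) ℝ, B * D = 1 := by
  obtain ⟨Y, hY, ho, rfl⟩ := h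
  exact TTN.exists_tensor_mul ho.kronBasis hY.exists_core_mul

/-- This is the upper bound r_{τ_i} for the rank of the i-th matricization, in the factorized form
needed by `mul_transpose_mul_of_range`. -/
theorem HasFullTreeRank.exists_tmat_eq {m : ℕ} {c : Fin m → OTree L} {B : V n r (.node c)}
    (h : HasFullTreeRank B) (i : Fin m) :
    ∃ (U : Matrix (Idx n (c i)) (Fin (r (c i))) ℝ) (G : Matrix (Fin (r (c i))) _ ℝ),
      tmat (β := fun j => Idx n (c j)) i B = U * G := by
  obtain ⟨Y, hY, ho, rfl⟩ := h
  cases Y with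
  | node C sub => exact ⟨_, _, tmat_tucker i C _⟩

theorem HasFullTreeRank.mul {τ : OTree L} {B : V n r τ} (h : HasFullTreeRank B)
    {M N : Matrix (Fin (r τ)) (Fin (r τ)) ℝ} (hNM : N * M = 1) :
    HasFullTreeRank (n := n) (τ := τ) (M * B) := by
  obtain ⟨Y, hY, ho, rfl⟩ := h
  exact ⟨Y.mulCore M, hY.mulCore hNM, ho.setCore _, Y.tensor_mulCore M⟩

theorem RestrictionsFullRank.hasFullTreeRank {τ : OTree L} {Y : TTN n r τ} {B : V n r τ}
    (h : RestrictionsFullRank Y B) : HasFullTreeRank B := by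
  cases Y with
  | leaf U => exact h
  | node C sub => exact h.1

end FullTreeRank

/-! ### Invariance of non-degeneracy, the sweep over the modes, and exactness -/

section Exactness

variable {L : Type*} {n : L → ℕ} {r : OTree L → ℕ}

theorem IsOrthDecomp.any {P : ∀ {k : ℕ}, Matrix (Fin k) (Fin k) ℝ → Prop} {ι : Type*} [Fintype ι]
    {k : ℕ} {M Q : Matrix ι (Fin k) ℝ} {R : Matrix (Fin k) (Fin k) ℝ} (h : IsOrthDecomp P M Q R) :
    IsOrthDecomp AnyFactor M Q R := ⟨h.eq_mul, h.orthonormal, trivial⟩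

/-- The non-degeneracy condition is invariant under contragredient changes of basis in mode `0`
of the network and of the restricted tensor. -/
theorem RestrictionsFullRank.mul {τ : OTree L} {Y : TTN n r τ} {B : V n r τ}
    (h : RestrictionsFullRank Y B) {M T : Matrix (Fin (r τ)) (Fin (r τ)) ℝ} (hMT : Mᵀ * T = 1) :
    RestrictionsFullRank (n := n) (τ := τ) (Y.mulCore T) (M * B) := by
  have hTM : Tᵀ * M = 1 := by
    rw [← Matrix.transpose_transpose M, ← Matrix.transpose_mul, hMT, Matrix.transpose_one]
  induction τ with
  | leaf l =>
    cases Y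
    exact h.hasFullTreeRank.mul hTM
  | @node m c ih =>
    obtain _ | ⟨C, sub⟩ := Y
    refine ⟨h.1.mul hTM, fun i => ?_⟩
    obtain ⟨Q, S, hQ, hR⟩ := h.2 i
    -- The old frame factor `Q`, transported by `T` in mode 0, keeps full column rank but loses
    -- orthonormality. Its own decomposition `Q' * R` supplies the new frame, and `R` becomes the
    -- change of basis passed to the direct subtree.
    have hZ : (Qᵀ * kronZero (fun j => Fin (r (c j))) i Mᵀ) *
        (kronZero (fun j => Fin (r (c j))) i T * Q) = 1 := by
      rw [Matrix.mul_assoc, ← Matrix.mul_assoc (kronZero (fun j => Fin (r (c j))) i Mᵀ), kronZero_mul (β := fun j => Fin (r (c j))), hMT, kronZero_one,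
        Matrix.one_mul, hQ.orthonormal]
    obtain ⟨Q', R, hQ'⟩ := hasDecomps_anyFactor _ _ hZ
    rw [hQ'.eq_mul, ← Matrix.mul_assoc] at hZ
    refine ⟨Q', S * Rᵀ, ⟨?_, hQ'.orthonormal, trivial⟩, ?_⟩
    · refine (congrArg Matrix.transpose (tmat_mul i T C)).trans ?_
      rw [Matrix.transpose_mul, Matrix.transpose_transpose, hQ.eq_mul, ← Matrix.mul_assoc,
        hQ'.eq_mul, Matrix.transpose_mul, Matrix.transpose_transpose, Matrix.mul_assoc]
    · set N := (Qᵀ * kronZero (fun j => Fin (r (c j))) i Mᵀ) * Q' with hN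
      have h1 := ih i hR (M := Nᵀ) (T := R) (by rw [Matrix.transpose_transpose]; exact hZ)
        (by rw [← Matrix.transpose_mul, hZ, Matrix.transpose_one])
      rw [TTN.mulCore_mulCore] at h1
      rw [Matrix.transpose_mul, Matrix.transpose_transpose]
      convert h1 using 1
      have h2 := tmat_mul_mul_frame (γ := fun j => Idx n (c j)) hMT hQ'.eq_mul
        (mul_eq_one_comm.mp hZ) B (fun j => (sub j).basis)
      refine (congrArg Matrix.transpose h2).trans ?_
      rw [Matrix.transpose_mul]
      rfl

section Node

variable {m : ℕ} {c : Fin m → OTree L}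

/-- The restriction as a linear map. -/
def restrictLin (i : Fin m)
    (W : Matrix (Fin (r (.node c)) × (∀ j : {j // j ≠ i}, Idx n (c j))) (Fin (r (c i))) ℝ) :
    V n r (.node c) →ₗ[ℝ] V n r (c i) where
  toFun := restrict i W
  map_add' X Y := by
    have h : tmat (β := fun j => Idx n (c j)) i (X + Y) = tmat i X + tmat i Y := rfl
    rw [_root_.restrict, h, Matrix.add_mul, Matrix.transpose_add]
    rfl
  map_smul' a X := by
    have h : tmat (β := fun j => Idx n (c j)) i (a • X) = a • tmat i X := rfl
    rw [_root_.restrict, h, Matrix.smul_mul, Matrix.transpose_smul]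
    rfl

/-- The state of the network after the subflows `Φ_τ^{(j)}`, `j < k`, for a curve from `B₀` to
`B₁`: the connection tensor is the core of `B₀` in the current bases, the first `k` bases span the
ranges of the matricizations of `B₁`, and the other direct subtrees are still the initial ones. -/
structure IsSweep (B₀ B₁ : V n r (.node c)) (sub₀ : ∀ j, TTN n r (c j)) (k : ℕ)
    (C : Matrix (Fin (r (.node c))) (∀ j, Fin (r (c j))) ℝ) (sub : ∀ j, TTN n r (c j)) :
    Prop where
  core_eq : C = tucker (β := fun j => Idx n (c j)) B₀ fun j => (sub j).basisᵀ
  orthonormal : ∀ j, (sub j).basisᵀ * (sub j).basis = 1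
  eq_initial : ∀ j : Fin m, k ≤ j → sub j = sub₀ j
  range : ∀ j : Fin m, j < k → (sub j).basis * (sub j).basisᵀ *
    tmat (β := fun j => Idx n (c j)) j B₁ = tmat (β := fun j => Idx n (c j)) j B₁

/-- The assumptions on the initial network `node C₀ sub₀` and on the final tensor `B₁`. -/
structure IsNondegenerateStart (B₁ : V n r (.node c))
    (C₀ : Matrix (Fin (r (.node c))) (∀ j, Fin (r (c j))) ℝ) (sub₀ : ∀ j, TTN n r (c j)) :
    Prop where
  fullRank : (TTN.node C₀ sub₀).FullRank
  orthonormal : (TTN.node C₀ sub₀).Orthonormal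
  restrictions : RestrictionsFullRank (TTN.node C₀ sub₀) B₁

variable {B₁ : V n r (.node c)} {C₀ C : Matrix (Fin (r (.node c))) (∀ j, Fin (r (c j))) ℝ}
  {sub₀ sub : ∀ j, TTN n r (c j)}

theorem IsNondegenerateStart.fix (h : IsNondegenerateStart B₁ C₀ sub₀) (j : Fin m) :
    (sub₀ j).basis * (sub₀ j).basisᵀ *
      tmat (β := fun j => Idx n (c j)) j (TTN.node C₀ sub₀).tensor =
        tmat (β := fun j => Idx n (c j)) j (TTN.node C₀ sub₀).tensor :=
  mul_transpose_mul_tmat_tucker (U := fun j => (sub₀ j).basis) (h.orthonormal j).basis C₀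

theorem IsNondegenerateStart.isSweep (h : IsNondegenerateStart B₁ C₀ sub₀) :
    IsSweep (TTN.node C₀ sub₀).tensor B₁ sub₀ 0 C₀ sub₀ where
  core_eq := by
    refine Eq.trans ?_ (tucker_tucker C₀ (fun j => (sub₀ j).basis) fun j => (sub₀ j).basisᵀ).symm
    rw [show (fun j => (sub₀ j).basisᵀ * (sub₀ j).basis) = fun j => 1 from
      funext fun j => (h.orthonormal j).basis, tucker_one]
  orthonormal j := (h.orthonormal j).basis
  eq_initial _ _ := rfl
  range j hj := absurd hj (Nat.not_lt_zero _)

/-- The connection tensor `C` is the core of `B₀` in the bases of `sub`, and each of the bases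
spans the range of the respective matricization of `B₀` or, in a mode other than `i`, of `B₁`. -/
structure IsAdapted (B₀ B₁ : V n r (.node c)) (i : Fin m)
    (C : Matrix (Fin (r (.node c))) (∀ j, Fin (r (c j))) ℝ) (sub : ∀ j, TTN n r (c j)) :
    Prop where
  core_eq : C = tucker (β := fun j => Idx n (c j)) B₀ fun j => (sub j).basisᵀ
  fix_self : (sub i).basis * (sub i).basisᵀ *
    tmat (β := fun j => Idx n (c j)) i B₀ = tmat (β := fun j => Idx n (c j)) i B₀
  fix_ne : ∀ j, j ≠ i → (sub j).basis * (sub j).basisᵀ *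
      tmat (β := fun j => Idx n (c j)) j B₁ = tmat (β := fun j => Idx n (c j)) j B₁ ∨
    (sub j).basis * (sub j).basisᵀ *
      tmat (β := fun j => Idx n (c j)) j B₀ = tmat (β := fun j => Idx n (c j)) j B₀

theorem IsNondegenerateStart.isAdapted (h : IsNondegenerateStart B₁ C₀ sub₀) (i : Fin m) :
    IsAdapted (TTN.node C₀ sub₀).tensor B₁ i C₀ sub₀ :=
  ⟨h.isSweep.core_eq, h.fix i, fun j _ => Or.inr (h.fix j)⟩

/-- Treated modes j < i span the range for the final tensor; the modes j ≥ i still carry the initial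
bases, which fix the initial tensor. -/
theorem IsSweep.isAdapted (h : IsNondegenerateStart B₁ C₀ sub₀) {i : Fin m}
    (hs : IsSweep (TTN.node C₀ sub₀).tensor B₁ sub₀ i C sub) :
    IsAdapted (TTN.node C₀ sub₀).tensor B₁ i C sub := by
  refine ⟨hs.core_eq, ?_, fun j _ => ?_⟩
  · rw [hs.eq_initial i le_rfl]
    exact h.fix i
  · rcases lt_or_ge (j : ℕ) i with hji | hji
    · exact Or.inl (hs.range j hji)
    · right
      rw [hs.eq_initial j hji]
      exact h.fix j

/-- The Gram matrix of `B₁` and `B₀` in mode `i` in terms of the current frame. -/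
theorem IsAdapted.gram {B₀ : V n r (.node c)} {i : Fin m} (h : IsAdapted B₀ B₁ i C sub) :
    tmat (β := fun j => Idx n (c j)) i B₁ * frame i (tmat i C)ᵀ (fun j => (sub j).basis) =
      tmat (β := fun j => Idx n (c j)) i B₁ *
        (tmat (β := fun j => Idx n (c j)) i B₀)ᵀ * (sub i).basis := by
  rw [h.core_eq]
  exact tmat_mul_frame_core (U := fun j => (sub j).basis) h.fix_ne

/-- The right-hand side involves no basis except the i-th, which is still the initial one when mode
i is reached. This makes the current and the initial frame comparable. -/
theorem IsAdapted.mul_vMat_mul {B₀ : V n r (.node c)} {i : Fin m} (h : IsAdapted B₀ B₁ i C sub)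
    {Q S} (hQ : IsOrthDecomp AnyFactor (tmat i C)ᵀ Q Sᵀ) :
    tmat (β := fun j => Idx n (c j)) i B₁ * vMat i Q sub * Sᵀ =
      tmat (β := fun j => Idx n (c j)) i B₁ *
        (tmat (β := fun j => Idx n (c j)) i B₀)ᵀ * (sub i).basis := by
  rw [← h.gram, hQ.eq_mul, frame_mul, ← Matrix.mul_assoc]
  rfl

theorem IsAdapted.restrict_initial {B₀ : V n r (.node c)} {i : Fin m}
    (h : IsAdapted B₀ B₁ i C sub) {Q S} (hQ : IsOrthDecomp AnyFactor (tmat i C)ᵀ Q Sᵀ) :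
    tmat (β := fun j => Idx n (c j)) i B₀ * vMat i Q sub = (sub i).basis * S :=
  tmat_mul_frame_self (U := fun j => (sub j).basis) h.fix_self
    (by rw [← hQ.eq_mul, h.core_eq]) hQ.orthonormal

/-- Non-degeneracy in the form of one-sided inverses: `D` comes from the full rank of the restricted
final tensor, `N` from the full rank of mat_i(C₀). -/
theorem IsNondegenerateStart.exists_initial_frame (h : IsNondegenerateStart B₁ C₀ sub₀)
    (i : Fin m) :
    ∃ Q S, ∃ (D : Matrix (Fin (r (c i))) (Idx n (c i)) ℝ) (N : Matrix (Fin (r (c i))) (Fin (r (c i))) ℝ),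
      IsOrthDecomp AnyFactor (tmat i C₀)ᵀ Q Sᵀ ∧
      RestrictionsFullRank ((sub₀ i).mulCore Sᵀ) (restrict i (vMat i Q sub₀) B₁) ∧
      D * (tmat (β := fun j => Idx n (c j)) i B₁ * vMat i Q sub₀) = 1 ∧ N * Sᵀ = 1 := by
  obtain ⟨Q, S, hQ, hR⟩ := h.restrictions.2 i
  obtain ⟨D, hD⟩ := hR.hasFullTreeRank.exists_mul_eq_one
  obtain ⟨E, hE⟩ := Matrix.exists_right_inverse_of_rank (h.fullRank.2.1 i)
  refine ⟨Q, S, Dᵀ, Eᵀ * Q, hQ, hR, ?_, ?_⟩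
  · rw [← Matrix.transpose_transpose (tmat i B₁ * _), ← Matrix.transpose_mul]
    exact (congrArg Matrix.transpose hD).trans Matrix.transpose_one
  · rw [Matrix.mul_assoc, ← hQ.eq_mul, ← Matrix.transpose_mul, hE, Matrix.transpose_one]

/-- By the Gram identity, a matrix times mat_i(C)ᵀ equals the product of mat_i(B₁) V and Sᵀ for the
initial frame, and this product has the left inverse `N * D`. Hence the current connection tensor
admits a QR decomposition. -/
theorem IsSweep.exists_left_inverse (h : IsNondegenerateStart B₁ C₀ sub₀) {i : Fin m}
    (hs : IsSweep (TTN.node C₀ sub₀).tensor B₁ sub₀ i C sub) :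
    ∃ D : Matrix (Fin (r (c i))) (Fin (r (.node c)) × ∀ j : {j // j ≠ i}, Fin (r (c j))) ℝ,
      D * (tmat i C)ᵀ = 1 := by
  obtain ⟨Q, S, D, N, hQ, -, hD, hN⟩ := h.exists_initial_frame i
  have h0 := (h.isAdapted i).mul_vMat_mul hQ
  have h1 := (hs.isAdapted h).gram
  rw [hs.eq_initial i le_rfl, ← h0, frame_eq] at h1
  refine ⟨N * D * (tmat (β := fun j => Idx n (c j)) i B₁ *
    kronRest (α := Fin (r (.node c))) i fun j => (sub j).basis), ?_⟩
  rw [Matrix.mul_assoc (N * D), Matrix.mul_assoc (tmat (β := fun j => Idx n (c j)) i B₁), h1,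
    Matrix.mul_assoc N, ← Matrix.mul_assoc D, hD, Matrix.one_mul, hN]

/-- These are the hypotheses of the induction for τ_i with the current frame. They are transported
from the initial frame along X Sᵀ = X₀ S₀ᵀ, where X and X₀ are the products of mat_i(B₁) with the
two frames. -/
theorem IsSweep.child (h : IsNondegenerateStart B₁ C₀ sub₀) {i : Fin m}
    (hs : IsSweep (TTN.node C₀ sub₀).tensor B₁ sub₀ i C sub) {Q S}
    (hQ : IsOrthDecomp AnyFactor (tmat i C)ᵀ Q Sᵀ) :
    ((sub i).mulCore Sᵀ).FullRank ∧ ((sub i).mulCore Sᵀ).Orthonormal ∧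
      ((sub i).mulCore Sᵀ).tensor = restrict i (vMat i Q sub) (TTN.node C₀ sub₀).tensor ∧
      RestrictionsFullRank ((sub i).mulCore Sᵀ) (restrict i (vMat i Q sub) B₁) := by
  obtain ⟨Q₀, S₀, D, N, hQ₀, hR, hD, hN⟩ := h.exists_initial_frame i
  have h0 := (h.isAdapted i).mul_vMat_mul hQ₀
  have h1 := (hs.isAdapted h).mul_vMat_mul hQ
  have h2 := (hs.isAdapted h).restrict_initial hQ
  rw [hs.eq_initial i le_rfl] at h1 h2 ⊢
  rw [← h0] at h1
  set X := tmat (β := fun j => Idx n (c j)) i B₁ * vMat i Q sub with hX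
  set X₀ := tmat (β := fun j => Idx n (c j)) i B₁ * vMat i Q₀ sub₀ with hX₀
  -- `N * D * X` is square, so it is a two-sided inverse of Sᵀ; in particular the current factor S
  -- is invertible.
  have hNS : N * D * X * Sᵀ = 1 := by
    rw [Matrix.mul_assoc, h1, Matrix.mul_assoc N, ← Matrix.mul_assoc D, hD, Matrix.one_mul, hN]
  have hSN := mul_eq_one_comm.mp hNS
  refine ⟨(h.fullRank.2.2 i).mulCore hNS, (h.orthonormal i).orthonormal.setCore _, ?_, ?_⟩
  · rw [TTN.tensor_mulCore, _root_.restrict, h2, Matrix.transpose_mul]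
    rfl
  · have h3 : Sᵀ * N * S₀ᵀ = Sᵀ := by rw [Matrix.mul_assoc, hN, Matrix.mul_one]
    -- The factor `T` is chosen to turn S₀ᵀ into Sᵀ in the network, and `M` is its contragredient,
    -- which carries X₀ᵀ to Xᵀ.
    have h4 := hR.mul (M := (S₀ᵀ * (N * D * X))ᵀ) (T := Sᵀ * N) (by
      rw [Matrix.transpose_transpose, Matrix.mul_assoc, ← Matrix.mul_assoc _ Sᵀ, hNS,
        Matrix.one_mul, mul_eq_one_comm.mp hN])
    rw [TTN.mulCore_mulCore, h3] at h4
    convert h4 using 1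
    rw [_root_.restrict, _root_.restrict, ← Matrix.transpose_mul]
    rw [← hX, ← hX₀, ← Matrix.mul_assoc, ← h1, Matrix.mul_assoc, hSN, Matrix.mul_one]

theorem mul_basis_setCore {τ : OTree L} {Y : TTN n r τ}
    {Q : Matrix (CoreIdx n r τ) (Fin (r τ)) ℝ} {S : Matrix (Fin (r τ)) (Fin (r τ)) ℝ}
    (hQ : Y.coreᵀ = Q * S) : (Y.setCore Qᵀ).basis * S = Y.basis := by
  rw [TTN.basis_setCore, Matrix.transpose_transpose, Matrix.mul_assoc, ← hQ, TTN.basis,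
    TTN.tensor_eq, Matrix.transpose_mul, Matrix.transpose_transpose]

theorem basis_setCore_orthonormal {τ : OTree L} {Y : TTN n r τ}
    (hY : Y.kronBasisᵀ * Y.kronBasis = 1) {Q : Matrix (CoreIdx n r τ) (Fin (r τ)) ℝ}
    (hQ : Qᵀ * Q = 1) : (Y.setCore Qᵀ).basisᵀ * (Y.setCore Qᵀ).basis = 1 := by
  rw [TTN.basis_setCore, Matrix.transpose_transpose, Matrix.transpose_mul, Matrix.mul_assoc,
    ← Matrix.mul_assoc _ Y.kronBasis, hY, Matrix.one_mul, hQ]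

/-- The orthonormalized result `X¹` of the integrator on `τ_i` spans the range of the
matricization of `B₁`. -/
theorem IsSweep.range_of_child (h : IsNondegenerateStart B₁ C₀ sub₀) {i : Fin m}
    (hs : IsSweep (TTN.node C₀ sub₀).tensor B₁ sub₀ i C sub) {Q S}
    (hQ : IsOrthDecomp AnyFactor (tmat i C)ᵀ Q Sᵀ) {Y : TTN n r (c i)}
    (hY : Y.tensor = restrict i (vMat i Q sub) B₁) (hY' : Y.kronBasisᵀ * Y.kronBasis = 1)
    {Qhat Shat} (hQhat : IsOrthDecomp AnyFactor Y.coreᵀ Qhat Shat) :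
    (Y.setCore Qhatᵀ).basis * (Y.setCore Qhatᵀ).basisᵀ *
      tmat (β := fun j => Idx n (c j)) i B₁ = tmat (β := fun j => Idx n (c j)) i B₁ := by
  obtain ⟨U, G, hU⟩ := h.restrictions.hasFullTreeRank.exists_tmat_eq i
  obtain ⟨D, hD⟩ := (hs.child h hQ).2.2.2.hasFullTreeRank.exists_mul_eq_one
  have hZ : tmat (β := fun j => Idx n (c j)) i B₁ * vMat i Q sub =
      (Y.setCore Qhatᵀ).basis * Shat := by
    rw [mul_basis_setCore hQhat.eq_mul, TTN.basis, hY, _root_.restrict,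
      Matrix.transpose_transpose]
  refine mul_transpose_mul_of_range hU (V := vMat i Q sub) (D := Dᵀ) ?_
    (basis_setCore_orthonormal hY' hQhat.orthonormal) hZ
  rw [← Matrix.transpose_transpose (tmat i B₁ * _), ← Matrix.transpose_mul]
  exact (congrArg Matrix.transpose hD).trans Matrix.transpose_one

/-- The differential equation for the square factor `S`. -/
theorem solvesTo_factor_iff {t₀ t₁ : ℝ} (ht : t₀ < t₁) {B B' : ℝ → V n r (.node c)}
    (hB : ∀ t ∈ Icc t₀ t₁, HasDerivWithinAt B (B' t) (Icc t₀ t₁) t) {i : Fin m}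
    (W : Matrix (Fin (r (.node c)) × (∀ j : {j // j ≠ i}, Idx n (c j))) (Fin (r (c i))) ℝ)
    (X : TTN n r (c i)) (S S' : Matrix (Fin (r (c i))) (Fin (r (c i))) ℝ) :
    SolvesTo (fun t (S' : Matrix (Fin (r (c i))) (Fin (r (c i))) ℝ) =>
        -(X.basisᵀ * (restrictFun i W (fun t _ => B' t) t (S'ᵀ * X.tensor))ᵀ)) t₀ t₁ S S' ↔
      S' = S - X.basisᵀ * (tmat (β := fun j => Idx n (c j)) i (B t₁) * W -
        tmat (β := fun j => Idx n (c j)) i (B t₀) * W) := by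
  let Λ : V n r (.node c) →ₗ[ℝ] Matrix (Fin (r (c i))) (Fin (r (c i))) ℝ :=
    { toFun := fun Z => -(X.basisᵀ * (restrictLin i W Z)ᵀ)
      map_add' := fun Y Z => by
        rw [map_add, Matrix.transpose_add, Matrix.mul_add, neg_add]
      map_smul' := fun a Z => by
        rw [map_smul, Matrix.transpose_smul, Matrix.mul_smul, RingHom.id_apply, smul_neg] }
  have h1 := solvesTo_iff_of_time_dependent ht (B := fun t => Λ (B t)) (B' := fun t => Λ (B' t))
    (fun t ht' => (hB t ht').matrix_linearMap Λ) S S'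
  refine h1.trans ?_
  have h2 : ∀ Z, Λ Z = -(X.basisᵀ * (tmat (β := fun j => Idx n (c j)) i Z * W)) := fun _ => rfl
  rw [h2, h2, Matrix.mul_sub]
  refine Eq.congr_right ?_
  abel

/-- Since mat_i(B₁) V = U¹ Ŝ and U¹ has orthonormal columns, the final part of the increment cancels
Ŝ exactly. What remains is U¹ᵀ mat_i(B₀) V, so the minus sign in the equation for S brings the core
back to the initial tensor. -/
theorem IsSweep.update (h : IsNondegenerateStart B₁ C₀ sub₀) {i : Fin m}
    (hs : IsSweep (TTN.node C₀ sub₀).tensor B₁ sub₀ i C sub) {Q S}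
    (hQ : IsOrthDecomp AnyFactor (tmat i C)ᵀ Q Sᵀ) {Y : TTN n r (c i)}
    (hY : Y.tensor = restrict i (vMat i Q sub) B₁) (hY' : Y.kronBasisᵀ * Y.kronBasis = 1)
    {Qhat Shat} (hQhat : IsOrthDecomp AnyFactor Y.coreᵀ Qhat Shat) {Stilde}
    (hS : Stilde = Shat - (Y.setCore Qhatᵀ).basisᵀ *
      (tmat (β := fun j => Idx n (c j)) i B₁ * vMat i Q sub -
        tmat (β := fun j => Idx n (c j)) i (TTN.node C₀ sub₀).tensor * vMat i Q sub)) :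
    IsSweep (TTN.node C₀ sub₀).tensor B₁ sub₀ (i + 1)
      (tten (β := fun j => Fin (r (c j))) i (Stilde * Qᵀ))
      (Function.update sub i (Y.setCore Qhatᵀ)) := by
  have ho := basis_setCore_orthonormal hY' hQhat.orthonormal
  have hZ : tmat (β := fun j => Idx n (c j)) i B₁ * vMat i Q sub =
      (Y.setCore Qhatᵀ).basis * Shat := by
    rw [mul_basis_setCore hQhat.eq_mul, TTN.basis, hY, _root_.restrict,
      Matrix.transpose_transpose]
  have hS' : Stilde * Qᵀ = (Y.setCore Qhatᵀ).basisᵀ * (sub i).basis * tmat i C := by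
    have h1 : tmat i C = S * Qᵀ := by
      rw [← Matrix.transpose_transpose (tmat i C), hQ.eq_mul, Matrix.transpose_mul,
        Matrix.transpose_transpose]
    rw [hS, hZ, (hs.isAdapted h).restrict_initial hQ, Matrix.mul_sub, ← Matrix.mul_assoc, ho,
      Matrix.one_mul, sub_sub_cancel, h1]
    simp only [Matrix.mul_assoc]
  refine ⟨?_, fun j => ?_, fun j hj => ?_, fun j hj => ?_⟩
  · have h1 := tten_mul_tmat_core (i := i) (T := (TTN.node C₀ sub₀).tensor)
      (γ := fun j => Idx n (c j)) (U := fun j => (sub j).basis) (hs.isAdapted h).fix_self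
      (U' := fun j => (Function.update sub i (Y.setCore Qhatᵀ) j).basis)
      (fun j hj => by simp only [Function.update_of_ne hj])
    rw [← h1, hS', Function.update_self, hs.core_eq]
  · by_cases hj : j = i
    · subst hj
      rw [Function.update_self]
      exact ho
    · rw [Function.update_of_ne hj]
      exact hs.orthonormal j
  · have hji : j ≠ i := fun e => by subst e; omega
    rw [Function.update_of_ne hji]
    exact hs.eq_initial j (by omega)
  · by_cases hji : j = i
    · subst hji
      rw [Function.update_self]
      exact hs.range_of_child h hQ hY hY' hQhat
    · rw [Function.update_of_ne hji]
      exact hs.range j (by have := Fin.val_ne_of_ne hji; omega)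

/-- After all m subflows every basis fixes the corresponding matricization of the final tensor, so
projecting in all modes loses nothing. -/
theorem IsSweep.tucker_final {B₀ : V n r (.node c)} (hs : IsSweep B₀ B₁ sub₀ m C sub) :
    tucker (tucker (β := fun j => Idx n (c j)) B₁ fun j => (sub j).basisᵀ)
      (fun j => (sub j).basis) = B₁ :=
  (tucker_tucker (β := fun j => Idx n (c j)) B₁ (fun j => (sub j).basisᵀ)
    fun j => (sub j).basis).trans (tucker_eq_self fun j => hs.range j j.2)

/-- The differential equation for the connection tensor. -/
theorem solvesTo_core_iff {t₀ t₁ : ℝ} (ht : t₀ < t₁) {B B' : ℝ → V n r (.node c)}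
    (hB : ∀ t ∈ Icc t₀ t₁, HasDerivWithinAt B (B' t) (Icc t₀ t₁) t)
    (hs : IsSweep (B t₀) (B t₁) sub₀ m C sub)
    (C' : Matrix (Fin (r (.node c))) (∀ j, Fin (r (c j))) ℝ) :
    SolvesTo (fun t (_ : Matrix (Fin (r (.node c))) (∀ i, Fin (r (c i))) ℝ) =>
        tucker (β := fun j => Idx n (c j)) (B' t) fun j => (sub j).basisᵀ) t₀ t₁ C C' ↔
      C' = tucker (β := fun j => Idx n (c j)) (B t₁) fun j => (sub j).basisᵀ := by
  let K := (kron fun j => (sub j).basisᵀ)ᵀ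
  let Λ : V n r (.node c) →ₗ[ℝ] Matrix (Fin (r (.node c))) (∀ j, Fin (r (c j))) ℝ :=
    { toFun := fun Z => (show Matrix (Fin (r (.node c))) (∀ j, Idx n (c j)) ℝ from Z) * K
      map_add' := fun Y Z => Matrix.add_mul _ _ _
      map_smul' := fun a Z => Matrix.smul_mul _ _ _ }
  have h2 : ∀ Z : V n r (.node c),
      tucker (β := fun j => Idx n (c j)) Z (fun j => (sub j).basisᵀ) = Λ Z :=
    fun Z => tucker_eq _ _
  have h1 := solvesTo_iff_of_time_dependent ht (B := fun t => Λ (B t)) (B' := fun t => Λ (B' t))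
    (fun t ht' => (hB t ht').matrix_linearMap Λ) C C'
  simp only [h2]
  rw [h1, hs.core_eq, h2, add_sub_cancel]

end Node

/-- A step of an iteration that can be continued as long as an invariant holds can be iterated. -/
theorem exists_chain {X : Type*} {m : ℕ} (Rel : Fin m → X → X → Prop) (Inv : ℕ → X → Prop) {x₀ : X}
    (h₀ : Inv 0 x₀) (hstep : ∀ (i : Fin m) x, Inv i x → ∃ y, Rel i x y ∧ Inv (i + 1) y) :
    ∃ Y : Fin (m + 1) → X, Y 0 = x₀ ∧ (∀ i : Fin m, Rel i (Y i.castSucc) (Y i.succ)) ∧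
      Inv m (Y (Fin.last m)) := by
  choose! f hf using hstep
  -- Beyond index m the sequence is continued by a constant; those values are never used.
  let g : ℕ → X := fun k => Nat.rec x₀ (fun k x => if hk : k < m then f ⟨k, hk⟩ x else x) k
  have hg : ∀ k (hk : k < m), g (k + 1) = f ⟨k, hk⟩ (g k) := fun k hk => dif_pos hk
  have hinv : ∀ k, k ≤ m → Inv k (g k) := by
    intro k
    induction k with
    | zero => exact fun _ => h₀
    | succ k ih =>
      intro hk
      rw [hg k hk]
      exact (hf ⟨k, hk⟩ (g k) (ih (by omega))).2
  refine ⟨fun k => g k, rfl, fun i => ?_, hinv m le_rfl⟩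
  change Rel i (g i) (g (i + 1))
  rw [hg i i.2]
  exact (hf i (g i) (hinv i i.2.le)).1

/-- The integrator is well defined and exact, for every condition on the square factors of the
orthogonal decompositions that can be satisfied. -/
theorem TTNStep.exact {P : ∀ {k : ℕ}, Matrix (Fin k) (Fin k) ℝ → Prop} (hP : HasDecomps P)
    {t₀ t₁ : ℝ} (ht : t₀ < t₁) {τ : OTree L} {B B' : ℝ → V n r τ}
    (hB : ∀ t ∈ Icc t₀ t₁, HasDerivWithinAt B (B' t) (Icc t₀ t₁) t) {Y₀ : TTN n r τ}
    (hY₀ : Y₀.FullRank) (hY₀' : Y₀.Orthonormal) (hY₀B : Y₀.tensor = B t₀)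
    (hR : RestrictionsFullRank Y₀ (B t₁)) :
    (∃ Y₁, TTNStep P t₀ t₁ τ (fun t _ => B' t) Y₀ Y₁) ∧
      ∀ Y₁, TTNStep P t₀ t₁ τ (fun t _ => B' t) Y₀ Y₁ →
        Y₁.tensor = B t₁ ∧ Y₁.kronBasisᵀ * Y₁.kronBasis = 1 := by
  -- Existence and exactness must be proved together: the subflow can continue after the recursive
  -- call only because the tensor returned is known to have full rank. The orthonormality of
  -- `kronBasis` is carried along so that replacing the core by an orthonormal factor gives an
  -- orthonormal basis matrix.
  induction τ with
  | leaf l =>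
    have key : ∀ Y₁ : TTN n r (.leaf l),
        TTNStep P t₀ t₁ (.leaf l) (fun t _ => B' t) Y₀ Y₁ ↔ Y₁.tensor = B t₁ := by
      intro Y₁
      refine (solvesTo_iff_of_time_dependent ht hB _ _).trans ?_
      rw [hY₀B, add_sub_cancel]
    refine ⟨⟨.leaf (Matrix.transpose (B t₁)), (key _).mpr rfl⟩, fun Y₁ hY₁ => ⟨(key _).mp hY₁, ?_⟩⟩
    refine TTN.Orthonormal.kronBasis ?_
    cases Y₁
    trivial
  | @node m c ih =>
    obtain _ | ⟨C₀, sub₀⟩ := Y₀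
    have h : IsNondegenerateStart (B t₁) C₀ sub₀ := ⟨hY₀, hY₀', hR⟩
    -- As the function ignores its argument, the prolongation drops out of F_{τ_i}, which is the
    -- derivative of the restricted curve. The induction hypothesis therefore applies to that curve.
    have hchild : ∀ {i : Fin m} {C sub} (hs : IsSweep (B t₀) (B t₁) sub₀ i C sub) {Q S}
        (hQ : IsOrthDecomp AnyFactor (tmat i C)ᵀ Q Sᵀ), _ := fun {i} {C} {sub} hs {Q} {S} hQ =>
      have hc := IsSweep.child h (by rw [hY₀B]; exact hs) hQ
      ih i (B := fun t => restrict i (vMat i Q sub) (B t))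
        (B' := fun t => restrict i (vMat i Q sub) (B' t))
        (fun t ht' => (hB t ht').matrix_linearMap (restrictLin i (vMat i Q sub)))
        hc.1 hc.2.1 (by rw [hc.2.2.1, hY₀B]) hc.2.2.2
    have hphi : ∀ {i : Fin m} {C sub} (_ : IsSweep (B t₀) (B t₁) sub₀ i C sub) {Y₁},
        SubflowPhi P t₀ t₁ i (TTNStep P t₀ t₁ (c i)) (fun t _ => B' t) (.node C sub) Y₁ →
        ∃ C' sub', Y₁ = .node C' sub' ∧ IsSweep (B t₀) (B t₁) sub₀ (i + 1) C' sub' := by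
      rintro i C sub hs Y₁ ⟨Q, S, hQ, Yi, hYi, Qhat, Shat, hQhat, Stilde, hS, rfl⟩
      obtain ⟨hY, hY'⟩ := (hchild hs hQ.any).2 Yi hYi
      rw [solvesTo_factor_iff ht hB, ← hY₀B] at hS
      rw [← hY₀B] at hs
      refine ⟨_, _, rfl, ?_⟩
      rw [← hY₀B]
      exact hs.update h hQ.any hY hY' hQhat.any hS
    have hphi_exists : ∀ {i : Fin m} {C sub} (_ : IsSweep (B t₀) (B t₁) sub₀ i C sub),
        ∃ Y₁, SubflowPhi P t₀ t₁ i (TTNStep P t₀ t₁ (c i)) (fun t _ => B' t) (.node C sub) Y₁ := by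
      intro i C sub hs
      obtain ⟨D, hD⟩ := IsSweep.exists_left_inverse h (by rw [hY₀B]; exact hs)
      obtain ⟨Q, R, hQ⟩ := hP _ _ hD
      rw [← Matrix.transpose_transpose R] at hQ
      obtain ⟨⟨Yi, hYi⟩, hspec⟩ := hchild hs hQ.any
      obtain ⟨hY, -⟩ := hspec Yi hYi
      -- The tensor of `Yi` is its core times a fixed matrix, so a right inverse of the tensor
      -- yields one of the core. The second orthogonal decomposition thus exists.
      have hYD : ∃ D : Matrix (Fin (r (c i))) (CoreIdx n r (c i)) ℝ, D * Yi.coreᵀ = 1 := by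
        obtain ⟨D, hD⟩ := (IsSweep.child h (by rw [hY₀B]; exact hs)
          hQ.any).2.2.2.hasFullTreeRank.exists_mul_eq_one
        refine ⟨(Yi.kronBasisᵀ * D)ᵀ, ?_⟩
        rw [← Matrix.transpose_mul, ← Matrix.mul_assoc, ← TTN.tensor_eq, hY]
        exact (congrArg Matrix.transpose hD).trans Matrix.transpose_one
      obtain ⟨D', hD'⟩ := hYD
      obtain ⟨Qhat, Shat, hQhat⟩ := hP _ _ hD'
      exact ⟨_, Q, Rᵀ, hQ, Yi, hYi, Qhat, Shat, hQhat, _,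
        (solvesTo_factor_iff ht hB _ _ _ _).mpr rfl, rfl⟩
    let Inv : ℕ → TTN n r (.node c) → Prop := fun k Y =>
      ∃ C sub, Y = .node C sub ∧ IsSweep (B t₀) (B t₁) sub₀ k C sub
    have hInv₀ : Inv 0 (.node C₀ sub₀) := ⟨_, _, rfl, by rw [← hY₀B]; exact h.isSweep⟩
    constructor
    · obtain ⟨Y, hY0, hrel, C, sub, hlast, hs⟩ := exists_chain
        (fun i => SubflowPhi P t₀ t₁ i (TTNStep P t₀ t₁ (c i)) (fun t _ => B' t)) Inv hInv₀ (by
          rintro i _ ⟨C, sub, rfl, hs⟩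
          obtain ⟨Y₁, hY₁⟩ := hphi_exists hs
          exact ⟨Y₁, hY₁, hphi hs hY₁⟩)
      have hpsi : ∃ Y₁, SubflowPsi t₀ t₁ (fun t _ => B' t) (Y (Fin.last m)) Y₁ := by
        rw [hlast]
        exact ⟨_, _, (solvesTo_core_iff ht hB hs _).mpr rfl, rfl⟩
      obtain ⟨Y₁, hY₁⟩ := hpsi
      exact ⟨Y₁, Y, hY0, hrel, hY₁⟩
    · rintro Y₁ ⟨Y, hY0, hrel, hpsi⟩
      have hInv : ∀ k (hk : k < m + 1), Inv k (Y ⟨k, hk⟩) := by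
        intro k
        induction k with
        | zero =>
          intro _
          rw [← hY0] at hInv₀
          exact hInv₀
        | succ k ihk =>
          intro hk
          obtain ⟨C, sub, hY, hs⟩ := ihk (by omega)
          have h1 := hrel ⟨k, by omega⟩
          rw [show Fin.castSucc ⟨k, by omega⟩ = (⟨k, by omega⟩ : Fin (m + 1)) from rfl, hY] at h1
          exact hphi hs h1
      obtain ⟨C, sub, hY, hs⟩ := hInv m (by omega)
      rw [show Fin.last m = ⟨m, by omega⟩ from rfl, hY] at hpsi
      obtain ⟨C₁, hC₁, rfl⟩ := hpsi
      refine ⟨?_, TTN.kronBasis_node_transpose_mul C₁ hs.orthonormal⟩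
      rw [(solvesTo_core_iff ht hB hs C₁).mp hC₁]
      exact hs.tucker_final

end Exactness

/-- Existence is taken with the strictest condition on the square factors and exactness with the
weakest, so that exactness covers every admissible choice of decompositions. -/
theorem theorem5p1 {L : Type*} (τ : OTree L) (hτ : τ.UnequalLeaves)
    (n : L → ℕ) (r : OTree L → ℕ) (hr : r τ = 1)
    (t₀ t₁ : ℝ) (ht : t₀ < t₁)
    (A A' : ℝ → OTree.V n r τ)
    (hA : ∀ t ∈ Set.Icc t₀ t₁, HasDerivWithinAt A (A' t) (Set.Icc t₀ t₁) t)
    (hA' : ContinuousOn A' (Set.Icc t₀ t₁))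
    (hrank : ∀ t ∈ Set.Icc t₀ t₁, HasFullTreeRank (A t))
    (Y₀ : TTN n r τ) (hY₀ : Y₀.FullRank) (hY₀' : Y₀.Orthonormal) (hY₀A : Y₀.tensor = A t₀)
    (hnondeg : RestrictionsFullRank Y₀ (A t₁)) :
    (∃ Y₁ : TTN n r τ, TTNStep IsUpperTri t₀ t₁ τ (fun t _ => A' t) Y₀ Y₁) ∧
      ∀ Y₁ : TTN n r τ, TTNStep AnyFactor t₀ t₁ τ (fun t _ => A' t) Y₀ Y₁ →
        Y₁.tensor = A t₁ := by
  exact ⟨(TTNStep.exact hasDecomps_isUpperTri ht hA hY₀ hY₀' hY₀A hnondeg).1, fun Y₁ hY₁ =>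
    ((TTNStep.exact hasDecomps_anyFactor ht hA hY₀ hY₀' hY₀A hnondeg).2 Y₁ hY₁).1⟩
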